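/- **Setting.** Let $\Delta=\mathrm{conv}(v_0,\dots,v_d)$ be the unit $d$-simplex ($v_0,\dots,v_d$ are the standard basis vectors of $\mathbb R^{d+1}$), $d\ge 1$, and let $T$ be a triangulation of $\Delta$ with $n$ vertices, labelled by $[n]$. A coloring of the vertices of $T$ with the colors $0,\dots,d$ is a *Sperner-coloring* if every vertex $x$ gets a color $i$ such that $v_i$ is a vertex of the smallest face of $\Delta$ containing $x$ (in particular $v_i$ gets color $i$). For $0\le t\le d+1$, the *Concatenation Sperner problem* $\mathsf{Sp}^t_{d,n}$ is the following two-player communication problem. The triangulation $T$ is publicly known. Player $A$ gets sets $C_0,\dots,C_{t-1}\subseteq[n]$ and player $B$ gets sets $C_t,\dots,C_d\subseteq[n]$. They have to output either a tuple $(x_0,\dots,x_d)\in C_0\times\cdots\times C_d$ whose entries are the $d+1$ distinct vertices of a simplex of $T$ (a panchromatic simplex), or a vertex $x$ which shows that $C_0,\dots,C_d$ are not the color classes of a Sperner-coloring, i.e. $x$ lies in none of the sets $C_i$, or in two of them, or in some $C_i$ such that $v_i$ is not a vertex of the smallest face of $\Delta$ containing $x$. **Theorem.** (a) For every $d\ge1$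 there is a constant $c$, depending only on $d$, such that for every $n$ and every triangulation $T$ of the unit $d$-simplex with $n$ vertices there is a deterministic protocol that solves $\mathsf{Sp}^{d-1}_{d,n}$ on $T$, on all inputs, with at most $c\log_2^2 n$ bits of communication. That is, $\mathsf{CC}_{\mathtt{det}}(\mathsf{Sp}^{d-1}_{d,n})=O(\log^2 n)$. (b) For every $1\le d\le4$ and every $0\le t\le d+1$ there is a constant $c$ such that for every $n$ and every triangulation $T$ of the unit $d$-simplex with $n$ vertices there is a deterministic protocol that solves $\mathsf{Sp}^{t}_{d,n}$ on $T$, on all inputs, with at most $c\log_2^2 n$ bits of communication. -/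

import Mathlib

/-! ### Deterministic two-player communication protocols -/

/-- A deterministic two-player protocol tree: at an inner node one of the players sends one bit,
which depends on that player's input (and on the node, i.e. on the bits sent so far); each leaf
carries the output. `X`, `Y` are the input types of the players `A`, `B`; `Z` is the type of
outputs. -/
inductive CommProtocol (X Y Z : Type) : Type
  | output (z : Z) : CommProtocol X Y Z
  | sendA (bit : X → Bool) (ifFalse ifTrue : CommProtocol X Y Z) : CommProtocol X Y Z
  | sendB (bit : Y → Bool) (ifFalse ifTrue : CommProtocol X Y Z) : CommProtocol X Y Z

namespace CommProtocol

/-- The output of the protocol on the input pair `(x, y)`. -/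
def run {X Y Z : Type} : CommProtocol X Y Z → X → Y → Z
  | output z, _, _ => z
  | sendA bit p q, x, y => if bit x then q.run x y else p.run x y
  | sendB bit p q, x, y => if bit y then q.run x y else p.run x y

/-- The worst-case number of bits sent, i.e. the depth of the protocol tree. -/
def cost {X Y Z : Type} : CommProtocol X Y Z → ℕ
  | output _ => 0
  | sendA _ p q => max p.cost q.cost + 1
  | sendB _ p q => max p.cost q.cost + 1

/-- The protocol solves the search problem `R`: on every input pair its output is valid. -/
def Solves {X Y Z : Type} (P : CommProtocol X Y Z) (R : X → Y → Z → Prop) : Prop :=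
  ∀ x y, R x y (P.run x y)

end CommProtocol

/-! ### Triangulations of the simplex -/

/-- A triangulation of the unit `d`-simplex `conv(v₀, …, v_d)`, where `v_i` is the `i`-th standard
basis vector of `ℝ^(d+1)`: a geometric simplicial complex whose underlying space is the simplex.
It has `n` vertices, labelled by `Fin n`. -/
structure SimplexTriangulation (d n : ℕ) where
  /-- The simplices of the triangulation. -/
  complex : Geometry.SimplicialComplex ℝ (Fin (d + 1) → ℝ)
  /-- They subdivide the unit simplex. -/
  space_eq : complex.space = stdSimplex ℝ (Fin (d + 1))
  /-- The labelling of the vertices. -/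
  label : Fin n ≃ complex.vertices

/-- The (index set of the) smallest face of the unit `d`-simplex that contains `x`: the
intersection of all `I` for which `x` lies in the face spanned by the `v_i`, `i ∈ I`. -/
def simplexCarrier {d : ℕ} (x : Fin (d + 1) → ℝ) : Set (Fin (d + 1)) :=
  ⋂₀ {I | x ∈ convexHull ℝ ((fun i => (Pi.single i 1 : Fin (d + 1) → ℝ)) '' I)}

/-- In coordinates, the smallest face containing `x` is given by the support of `x`. -/
theorem mem_simplexCarrier_iff {d : ℕ} {x : Fin (d + 1) → ℝ}
    (hx : x ∈ stdSimplex ℝ (Fin (d + 1))) (i : Fin (d + 1)) :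
    i ∈ simplexCarrier x ↔ x i ≠ 0 := by
  classical
  constructor
  · intro h
    have key : x ∈ convexHull ℝ
        ((fun i => (Pi.single i 1 : Fin (d + 1) → ℝ)) '' {j | x j ≠ 0}) := by
      have hsum : x = ∑ j ∈ Finset.univ.filter (fun j => x j ≠ 0),
          x j • (Pi.single j 1 : Fin (d + 1) → ℝ) := by
        funext k
        simp [Finset.sum_apply, Pi.single_apply]
      have hmem : ∑ j ∈ Finset.univ.filter (fun j => x j ≠ 0),
          x j • (Pi.single j 1 : Fin (d + 1) → ℝ) ∈ convexHull ℝ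
            ((fun i => (Pi.single i 1 : Fin (d + 1) → ℝ)) '' {j | x j ≠ 0}) := by
        refine (convex_convexHull ℝ _).sum_mem (fun j _ => hx.1 j) ?_ ?_
        · rw [Finset.sum_filter_ne_zero]
          exact hx.2
        · intro j hj
          exact subset_convexHull ℝ _ ⟨j, (Finset.mem_filter.1 hj).2, rfl⟩
      rwa [← hsum] at hmem
    exact Set.mem_sInter.1 h _ key
  · intro h
    refine Set.mem_sInter.2 fun I hI => ?_
    by_contra hi
    have hsub : convexHull ℝ ((fun i => (Pi.single i 1 : Fin (d + 1) → ℝ)) '' I) ⊆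
        {y | y i = 0} := by
      refine convexHull_min ?_ ?_
      · rintro _ ⟨j, hj, rfl⟩
        have : i ≠ j := fun hij => hi (hij ▸ hj)
        simp [this]
      · intro y hy z hz a b _ _ _
        have hy' : y i = 0 := hy
        have hz' : z i = 0 := hz
        simp [hy', hz']
    exact h (hsub hI)

/-! ### The Concatenation Sperner problem -/

/-- Player `A`'s input: the sets `C_i ⊆ [n]` for the first `t` colors `i < t`. -/
abbrev SpernerInputA (d n t : ℕ) : Type := {i : Fin (d + 1) // (i : ℕ) < t} → Finset (Fin n)

/-- Player `B`'s input: the sets `C_i ⊆ [n]` for the remaining colors `t ≤ i ≤ d`. -/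
abbrev SpernerInputB (d n t : ℕ) : Type := {i : Fin (d + 1) // t ≤ (i : ℕ)} → Finset (Fin n)

/-- The sets `C_0, …, C_d` given jointly by the two inputs. -/
def spernerClasses {d n t : ℕ} (a : SpernerInputA d n t) (b : SpernerInputB d n t)
    (i : Fin (d + 1)) : Finset (Fin n) :=
  if h : (i : ℕ) < t then a ⟨i, h⟩ else b ⟨i, not_lt.1 h⟩

/-- The possible outputs: a tuple `(x_0, …, x_d)` of vertices, claimed to be a panchromatic
simplex, or one vertex, claimed to show that the inputs are not the color classes of a
Sperner-coloring. -/
inductive SpernerOutput (d n : ℕ) : Type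
  | simplex (x : Fin (d + 1) → Fin n) : SpernerOutput d n
  | violation (x : Fin n) : SpernerOutput d n

namespace SimplexTriangulation

variable {d n : ℕ}

/-- The position of the vertex with label `k`. -/
def point (T : SimplexTriangulation d n) (k : Fin n) : Fin (d + 1) → ℝ := (T.label k).1

/-- `x` is a panchromatic simplex for the classes `C`: a tuple in `C_0 × ⋯ × C_d` whose entries
are the `d + 1` distinct vertices of a simplex of the triangulation. -/
def IsPanchromatic (T : SimplexTriangulation d n) (C : Fin (d + 1) → Finset (Fin n))
    (x : Fin (d + 1) → Fin n) : Prop :=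
  (∀ i, x i ∈ C i) ∧ Function.Injective x ∧
    ∃ s ∈ T.complex.faces, (s : Set (Fin (d + 1) → ℝ)) = Set.range (fun i => T.point (x i))

/-- The vertex `x` shows that `C_0, …, C_d` are not the color classes of a Sperner-coloring:
it has no color, or two different colors, or a color `i` such that `v_i` is not a vertex of the
smallest face containing `x`. The last case includes a corner `v_j` with a color `i ≠ j`. -/
def IsViolation (T : SimplexTriangulation d n) (C : Fin (d + 1) → Finset (Fin n))
    (x : Fin n) : Prop :=
  (∀ i, x ∉ C i) ∨ (∃ i j, i ≠ j ∧ x ∈ C i ∧ x ∈ C j) ∨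
    (∃ i, x ∈ C i ∧ i ∉ simplexCarrier (T.point x))

/-- The Concatenation Sperner problem on the publicly known triangulation `T`, where player `A`
holds the first `t` colors and player `B` the others: which outputs are valid on which inputs. -/
def concatSperner (T : SimplexTriangulation d n) (t : ℕ) (a : SpernerInputA d n t)
    (b : SpernerInputB d n t) : SpernerOutput d n → Prop
  | .simplex x => T.IsPanchromatic (spernerClasses a b) x
  | .violation x => T.IsViolation (spernerClasses a b) x

end SimplexTriangulation

/-! For `d ≤ 4` every split leaves one player with all classes except at most two. If at most one
class is missing, that player completes the data and announces a valid output, and the other player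
answers at most one membership query. The essential case is that `A` knows all colors but `i` and
`j`; it also gives (a), where `t = d - 1`.

Let `A` color every vertex by a known class containing it, and by `i` if there is none. Color `j`
never occurs. If no vertex already refutes the known classes, this is a Sperner-coloring of the
facet opposite to `j`. Call a `(d-1)`-simplex with all colors but `j` a door. A `d`-simplex has zero
or two doors, an interior door lies in two `d`-simplices and a boundary door in one. Boundary doors
lie opposite to `j` or opposite to `i`, since a facet opposite to any other color lacks that color.
By Sperner's lemma the doors opposite to `j` are odd in number, so parity forces a walk from one of
them to a door opposite to `i`.

Along this walk follow the vertex colored `i`, which lies in no class of `A`. At the start color `j`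
would be illegal, at the end color `i` would be. Hence either one of these vertices is a violation,
or membership changes from `C i` to `C j` between two consecutive doors. There the first door
together with the new vertex is panchromatic, or both vertices agree and lie in two classes. There
are at most `n ^ d` doors, so binary search needs `O(d log n)` rounds of `O(log n)` bits.

The geometric input is `existsUnique_coface` and `exists_two_cofaces`, the parity arguments are
`odd_card_panchromatic` and `exists_reachable_doors`, and `exists_vertex_sequence` feeds the
protocol `solvable_of_all_but_two`. -/

/-! ### Geometry: cofaces of codimension one simplices in a triangulated simplex. -/

section Geometry

variable {ι : Type*} [Fintype ι]

theorem sum_eq_zero_weights_of_linearIndepOn {E : Type*} [AddCommGroup E] [Module ℝ E]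
    {s : Finset E} (hs : LinearIndepOn ℝ id (s : Set E)) {f g : E → ℝ}
    (h : ∑ x ∈ s, f x • x = ∑ x ∈ s, g x • x) : ∀ x ∈ s, f x = g x := by
  have := linearIndepOn_finset_iff.1 hs (fun x => f x - g x) (by
    simp [sub_smul, Finset.sum_sub_distrib, h])
  intro x hx
  exact sub_eq_zero.1 (this x hx)

theorem card_le_of_linearIndepOn_of_support {s : Finset (ι → ℝ)} {I : Finset ι}
    (hs : LinearIndepOn ℝ id (s : Set (ι → ℝ))) (hI : ∀ x ∈ s, ∀ i ∉ I, x i = 0) :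
    s.card ≤ I.card := by
  classical
  have h := linearIndependent_le_span_aux' _ hs
    ((I.image (fun i => (Pi.single i 1 : ι → ℝ)) : Finset (ι → ℝ)) : Set (ι → ℝ)) (by
      rintro _ ⟨⟨x, hx⟩, rfl⟩
      have hx' : x = ∑ i ∈ I, x i • (Pi.single i 1 : ι → ℝ) := by
        funext k
        by_cases hk : k ∈ I <;> simp [Finset.sum_apply, Pi.single_apply, hk]
        exact hI x hx k hk
      simp only [id]
      rw [hx']
      refine Submodule.sum_mem _ fun i hi => Submodule.smul_mem _ _ (Submodule.subset_span ?_)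
      simpa using ⟨i, hi, rfl⟩)
  refine le_trans ?_ (h.trans ?_)
  · simp
  · simpa using Finset.card_image_le

theorem exists_single_notMem_span {s : Finset (ι → ℝ)} {I : Finset ι} [DecidableEq ι]
    (h : s.card < I.card) :
    ∃ i ∈ I, (Pi.single i 1 : ι → ℝ) ∉ Submodule.span ℝ (s : Set (ι → ℝ)) := by
  classical
  by_contra! hc
  have hli : LinearIndependent ℝ (fun i : I => (Pi.single (i : ι) 1 : ι → ℝ)) := by
    have := (Pi.basisFun ℝ ι).linearIndependent.comp (fun i : I => (i : ι))
      Subtype.val_injective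
    convert this using 2
    simp
  have h2 := linearIndependent_le_span_aux' _ hli (s : Set (ι → ℝ)) (by
    rintro _ ⟨i, rfl⟩
    exact hc i i.2)
  simp at h2
  omega

/-- By dimension, `span s` is a hyperplane in the coordinate subspace of `I`, and `u` spans a
complement. The sign of `c` will tell on which side of `s` the vertex `w` lies. -/
theorem mem_span_insert_of_card {s : Finset (ι → ℝ)} {I : Finset ι} {u w : ι → ℝ}
    (hs : LinearIndepOn ℝ id (s : Set (ι → ℝ))) (hI : ∀ x ∈ s, ∀ i ∉ I, x i = 0)
    (hc : s.card + 1 = I.card) (hu : u ∉ Submodule.span ℝ (s : Set (ι → ℝ)))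
    (huI : ∀ i ∉ I, u i = 0) (hwI : ∀ i ∉ I, w i = 0) :
    ∃ c : ℝ, w - c • u ∈ Submodule.span ℝ (s : Set (ι → ℝ)) := by
  classical
  have h1 := hs.id_insert hu
  by_cases hw : w ∈ Submodule.span ℝ (insert u (s : Set (ι → ℝ)))
  · obtain ⟨c, z, hz, rfl⟩ := Submodule.mem_span_insert.1 hw
    exact ⟨c, by simpa using hz⟩
  · have h2 := h1.id_insert hw
    have h3 := card_le_of_linearIndepOn_of_support (s := insert w (insert u s)) (I := I)
      (by simpa using h2) (by
        intro x hx
        rcases Finset.mem_insert.1 hx with rfl | hx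
        · exact hwI
        rcases Finset.mem_insert.1 hx with rfl | hx
        · exact huI
        exact hI x hx)
    have hu' : u ∉ s := fun h => hu (Submodule.subset_span h)
    have hw' : w ∉ insert u s := fun h => hw (Submodule.subset_span (by simpa using h))
    rw [Finset.card_insert_of_notMem hw', Finset.card_insert_of_notMem hu'] at h3
    omega

namespace Geometry.SimplicialComplex

variable {K : SimplicialComplex ℝ (ι → ℝ)}

theorem mem_stdSimplex_of_mem_face (hK : K.space = stdSimplex ℝ ι) {s : Finset (ι → ℝ)}
    (hs : s ∈ K.faces) {x : ι → ℝ} (hx : x ∈ s) : x ∈ stdSimplex ℝ ι :=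
  hK ▸ K.subset_space hs hx

/-- All vertices lie on the hyperplane where the coordinates sum to 1, so the weights of a linear
relation sum to 0 and affine independence applies. Hence linear spans can replace affine spans
throughout. -/
theorem linearIndepOn_face (hK : K.space = stdSimplex ℝ ι) {s : Finset (ι → ℝ)}
    (hs : s ∈ K.faces) : LinearIndepOn ℝ id (s : Set (ι → ℝ)) := by
  rw [linearIndepOn_finset_iff]
  intro f hf x hx
  simp only [id] at hf
  have hsum : ∑ y ∈ s, f y = 0 := by
    have h := congrArg (fun v : ι → ℝ => ∑ i, v i) hf
    simp only [Finset.sum_apply, Pi.smul_apply, smul_eq_mul, Pi.zero_apply,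
      Finset.sum_const_zero] at h
    rw [Finset.sum_comm] at h
    rw [← h]
    refine Finset.sum_congr rfl fun y hy => ?_
    rw [← Finset.mul_sum, (mem_stdSimplex_of_mem_face hK hs hy).2, mul_one]
  have hi := affineIndependent_iff.1 (K.indep hs) Finset.univ (fun y => f y)
    (by rw [← hsum]; exact Finset.sum_coe_sort s f)
    (by rw [← hf]; exact Finset.sum_coe_sort s (fun y => f y • y))
  exact hi ⟨x, hx⟩ (Finset.mem_univ _)

/-- A point of the relative interior of `s` lies in no face that does not contain `s`. -/
theorem subset_of_mem_convexHull (hK : K.space = stdSimplex ℝ ι) {s t : Finset (ι → ℝ)}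
    (hs : s ∈ K.faces) (ht : t ∈ K.faces) {a : (ι → ℝ) → ℝ} (ha : ∀ x ∈ s, 0 < a x)
    (ha1 : ∑ x ∈ s, a x = 1) (h : ∑ x ∈ s, a x • x ∈ convexHull ℝ (t : Set (ι → ℝ))) :
    s ⊆ t := by
  classical
  have h1 : ∑ x ∈ s, a x • x ∈ convexHull ℝ (s : Set (ι → ℝ)) :=
    Finset.mem_convexHull'.2 ⟨a, fun x hx => (ha x hx).le, ha1, rfl⟩
  have h2 := K.inter_subset_convexHull hs ht ⟨h1, h⟩
  rw [← Finset.coe_inter] at h2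
  obtain ⟨b, -, -, hb⟩ := Finset.mem_convexHull'.1 h2
  have hb' : ∑ x ∈ s, (if x ∈ t then b x else 0) • x = ∑ x ∈ s, a x • x := by
    rw [← hb, ← Finset.filter_mem_eq_inter, Finset.sum_filter]
    refine Finset.sum_congr rfl fun x _ => ?_
    split_ifs <;> simp
  intro x hx
  by_contra hxt
  have := sum_eq_zero_weights_of_linearIndepOn (linearIndepOn_face hK hs) hb' x hx
  simp only [hxt, if_false] at this
  exact (ha x hx).ne this

-- Finitely many faces cover the short segment starting at `p`, so one of them is met for
-- arbitrarily small `ε`; it is closed and therefore contains `p`.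
omit [Fintype ι] in
theorem exists_face_of_eventually {p u : ι → ℝ} (hfin : K.faces.Finite)
    (h : ∀ᶠ ε : ℝ in nhdsWithin 0 (Set.Ioi 0), p + ε • u ∈ K.space) :
    ∃ t ∈ K.faces, p ∈ convexHull ℝ (t : Set (ι → ℝ)) ∧
      ∃ ε : ℝ, 0 < ε ∧ p + ε • u ∈ convexHull ℝ (t : Set (ι → ℝ)) := by
  have hf : ∃ t ∈ K.faces, ∃ᶠ ε : ℝ in nhdsWithin 0 (Set.Ioi 0),
      p + ε • u ∈ convexHull ℝ (t : Set (ι → ℝ)) := by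
    by_contra! hc
    have hall : ∀ᶠ ε : ℝ in nhdsWithin 0 (Set.Ioi 0), ∀ t ∈ K.faces,
        p + ε • u ∉ convexHull ℝ (t : Set (ι → ℝ)) :=
      (Filter.eventually_all_finite hfin).2 fun t ht => by simpa using hc t ht
    obtain ⟨ε, h1, h2⟩ := (h.and hall).exists
    obtain ⟨t, ht, hm⟩ := mem_space_iff.1 h1
    exact h2 t ht hm
  obtain ⟨t, ht, hfr⟩ := hf
  refine ⟨t, ht, ?_, ?_⟩
  · refine (t.finite_toSet.isClosed_convexHull ℝ).mem_of_frequently_of_tendsto hfr ?_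
    have : Continuous fun ε : ℝ => p + ε • u := by fun_prop
    simpa using (this.tendsto 0).mono_left (nhdsWithin_le_nhds (s := Set.Ioi 0))
  · obtain ⟨ε, h1, h2⟩ := (hfr.and_eventually self_mem_nhdsWithin).exists
    exact ⟨ε, h2, h1⟩

/-- If the direction `u` points into the simplex at a relative interior point of the face `s`, then
`s` has a coface in this direction. -/
theorem exists_coface (hK : K.space = stdSimplex ℝ ι) (hfin : K.faces.Finite)
    {s : Finset (ι → ℝ)} [DecidableEq (ι → ℝ)] {I : Finset ι} (hs : s ∈ K.faces)
    (hI : ∀ x ∈ s, ∀ i ∉ I, x i = 0) (hc : s.card + 1 = I.card)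
    {a : (ι → ℝ) → ℝ} (ha : ∀ x ∈ s, 0 < a x) (ha1 : ∑ x ∈ s, a x = 1)
    {u : ι → ℝ} (huI : ∀ i ∉ I, u i = 0) (hu : u ∉ Submodule.span ℝ (s : Set (ι → ℝ)))
    (h : ∀ᶠ ε : ℝ in nhdsWithin 0 (Set.Ioi 0), ∑ x ∈ s, a x • x + ε • u ∈ stdSimplex ℝ ι) :
    ∃ w, w ∉ s ∧ insert w s ∈ K.faces ∧ (∀ i ∉ I, w i = 0) ∧
      ∃ c : ℝ, 0 < c ∧ w - c • u ∈ Submodule.span ℝ (s : Set (ι → ℝ)) := by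
  obtain ⟨t, ht, hpt, ε, hε, hy⟩ := exists_face_of_eventually hfin (hK ▸ h)
  have hst := subset_of_mem_convexHull hK hs ht ha ha1 hpt
  obtain ⟨b, hb, hb1, hbs⟩ := Finset.mem_convexHull'.1 hy
  have hspan : ∀ f : (ι → ℝ) → ℝ, ∑ x ∈ s, f x • x ∈ Submodule.span ℝ (s : Set (ι → ℝ)) :=
    fun f => Submodule.sum_mem _ fun x hx => Submodule.smul_mem _ _ (Submodule.subset_span hx)
  -- Coordinates outside `I` vanish at the displaced point and are nonnegative at the vertices, so
  -- they vanish at each vertex of nonzero weight.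
  have hsupp : ∀ x ∈ t, b x ≠ 0 → ∀ i ∉ I, x i = 0 := by
    intro x hx hbx i hi
    have h0 : ∑ y ∈ t, b y * y i = 0 := by
      have := congrFun hbs i
      simp only [Finset.sum_apply, Pi.smul_apply, smul_eq_mul, Pi.add_apply, huI i hi, mul_zero,
        add_zero] at this
      rw [this]
      exact Finset.sum_eq_zero fun y hy => by rw [hI y hy i hi, mul_zero]
    have h1 := (Finset.sum_eq_zero_iff_of_nonneg fun y hy =>
      mul_nonneg (hb y hy) ((mem_stdSimplex_of_mem_face hK ht hy).1 i)).1 h0 x hx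
    exact (mul_eq_zero.1 h1).resolve_left hbx
  have hex : ∃ w ∈ t, w ∉ s ∧ b w ≠ 0 := by
    by_contra! hcon
    apply hu
    have h1 : ∑ x ∈ t, b x • x = ∑ x ∈ s, b x • x :=
      (Finset.sum_subset hst fun x hx hxs => by rw [hcon x hx hxs, zero_smul]).symm
    have h2 : ε • u ∈ Submodule.span ℝ (s : Set (ι → ℝ)) := by
      have : ε • u = ∑ x ∈ s, b x • x - ∑ x ∈ s, a x • x := by rw [← h1, hbs]; abel
      rw [this]
      exact Submodule.sub_mem _ (hspan b) (hspan a)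
    exact (Submodule.smul_mem_iff _ hε.ne').1 h2
  obtain ⟨w, hwt, hws, hbw⟩ := hex
  have hins : insert w s ⊆ t := Finset.insert_subset hwt hst
  have hwI := hsupp w hwt hbw
  refine ⟨w, hws, K.down_closed ht hins (Finset.insert_nonempty _ _), hwI, ?_⟩
  -- A second new vertex of nonzero weight would give `I.card + 1` independent vectors supported on
  -- `I`.
  have hfil : ∀ x ∈ t, x ∉ insert w s → b x = 0 := by
    intro x hx hxs
    by_contra hbx
    have h3 := card_le_of_linearIndepOn_of_support (s := insert x (insert w s)) (I := I)
      ((linearIndepOn_face hK ht).mono (by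
        exact_mod_cast Finset.insert_subset hx hins)) (by
        intro y hy
        rcases Finset.mem_insert.1 hy with rfl | hy
        · exact hsupp _ hx hbx
        rcases Finset.mem_insert.1 hy with rfl | hy
        · exact hwI
        exact hI y hy)
    rw [Finset.card_insert_of_notMem hxs, Finset.card_insert_of_notMem hws] at h3
    omega
  have hsum : ∑ x ∈ s, a x • x + ε • u = b w • w + ∑ x ∈ s, b x • x := by
    rw [← hbs, ← Finset.sum_insert (f := fun x => b x • x) hws]
    exact (Finset.sum_subset hins fun x hx hxs => by rw [hfil x hx hxs, zero_smul]).symm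
  have hbpos : 0 < b w := lt_of_le_of_ne (hb w hwt) (Ne.symm hbw)
  refine ⟨ε / b w, div_pos hε hbpos, ?_⟩
  refine (Submodule.smul_mem_iff _ hbw).1 ?_
  have : b w • (w - (ε / b w) • u) = ∑ x ∈ s, a x • x - ∑ x ∈ s, b x • x := by
    rw [smul_sub, smul_smul, mul_div_cancel₀ _ hbw]
    have h4 : b w • w = ∑ x ∈ s, a x • x + ε • u - ∑ x ∈ s, b x • x := by rw [hsum]; abel
    rw [h4]; abel
  rw [this]
  exact Submodule.sub_mem _ (hspan a) (hspan b)

theorem notMem_span_of_insert (hK : K.space = stdSimplex ℝ ι)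
    {s : Finset (ι → ℝ)} [DecidableEq (ι → ℝ)] {w : ι → ℝ}
    (hw : w ∉ s) (hws : insert w s ∈ K.faces) : w ∉ Submodule.span ℝ (s : Set (ι → ℝ)) := by
  have hind := linearIndepOn_face hK hws
  intro hm
  obtain ⟨f, hf⟩ := Submodule.mem_span_finset.1 hm
  have h0 := sum_eq_zero_weights_of_linearIndepOn hind
    (f := fun x => if x = w then 1 else 0) (g := fun x => if x = w then 0 else f x) (by
      rw [Finset.sum_insert hw, Finset.sum_insert hw]
      simp only [if_true, one_smul, zero_smul, zero_add]
      have hxw : ∀ x ∈ s, x ≠ w := fun x hx => ne_of_mem_of_not_mem hx hw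
      have h1 : ∑ x ∈ s, (if x = w then (1 : ℝ) else 0) • x = 0 :=
        Finset.sum_eq_zero fun x hx => by rw [if_neg (hxw x hx), zero_smul]
      have h2 : ∑ x ∈ s, (if x = w then (0 : ℝ) else f x) • x = ∑ x ∈ s, f x • x :=
        Finset.sum_congr rfl fun x hx => by rw [if_neg (hxw x hx)]
      rw [h1, h2, hf.2, add_zero])
      w (Finset.mem_insert_self _ _)
  simp at h0

/-- Two cofaces on the same side of `s` overlap: a small step from the barycenter of `s` towards `w`
stays in the simplex on `w'`. If `w ≠ w'`, the intersection property puts this point into the hull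
of `s`, which forces `w` into `span s`. -/
theorem coface_unique (hK : K.space = stdSimplex ℝ ι)
    {s : Finset (ι → ℝ)} [DecidableEq (ι → ℝ)] (hne : s.Nonempty) {u w w' : ι → ℝ}
    (hw : w ∉ s) (hws : insert w s ∈ K.faces) (hw' : w' ∉ s) (hws' : insert w' s ∈ K.faces)
    {c c' : ℝ} (hc : 0 < c) (hc' : 0 < c')
    (h : w - c • u ∈ Submodule.span ℝ (s : Set (ι → ℝ)))
    (h' : w' - c' • u ∈ Submodule.span ℝ (s : Set (ι → ℝ))) : w = w' := by
  by_contra hww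
  have hwspan := notMem_span_of_insert hK hw hws
  have hcomb : w - (c / c') • w' ∈ Submodule.span ℝ (s : Set (ι → ℝ)) := by
    have : w - (c / c') • w' = (w - c • u) - (c / c') • (w' - c' • u) := by
      rw [smul_sub, smul_smul, div_mul_cancel₀ _ hc'.ne']; abel
    rw [this]
    exact Submodule.sub_mem _ h (Submodule.smul_mem _ _ h')
  obtain ⟨g, -, hg⟩ := Submodule.mem_span_finset.1 hcomb
  have hκ : 0 < c / c' := div_pos hc hc'
  set κ := c / c'
  have hm : (0 : ℝ) < s.card := by exact_mod_cast hne.card_pos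
  -- a small step towards `w` stays in the simplex on `w'`
  have hev : ∀ᶠ ε : ℝ in nhdsWithin 0 (Set.Ioi 0), ε < 1 ∧
      ∀ x ∈ s, 0 ≤ (1 - ε) * (s.card : ℝ)⁻¹ + ε * g x := by
    refine Filter.Eventually.filter_mono nhdsWithin_le_nhds ((eventually_lt_nhds one_pos).and ?_)
    refine (Filter.eventually_all_finset s).2 fun x _ => ?_
    have hcont : Continuous fun ε : ℝ => (1 - ε) * (s.card : ℝ)⁻¹ + ε * g x := by fun_prop
    have := hcont.tendsto 0
    simp only [sub_zero, one_mul, zero_mul, add_zero] at this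
    exact (this.eventually (lt_mem_nhds (inv_pos.2 hm))).mono fun _ h => h.le
  obtain ⟨ε, ⟨hε1, hεs⟩, hε0⟩ := (hev.and self_mem_nhdsWithin).exists
  have hε0 : 0 < ε := hε0
  set y : ι → ℝ := ε • w + ∑ x ∈ s, ((1 - ε) * (s.card : ℝ)⁻¹) • x with hy
  have hcard : ∑ x ∈ s, (1 - ε) * (s.card : ℝ)⁻¹ = 1 - ε := by
    rw [Finset.sum_const, nsmul_eq_mul]
    field_simp
  have hy1 : y ∈ convexHull ℝ ((insert w s : Finset (ι → ℝ)) : Set (ι → ℝ)) := by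
    refine Finset.mem_convexHull'.2 ⟨fun x => if x = w then ε else (1 - ε) * (s.card : ℝ)⁻¹, ?_, ?_, ?_⟩
    · intro x _
      dsimp only
      split_ifs
      · exact hε0.le
      · exact mul_nonneg (by linarith) (inv_pos.2 hm).le
    · rw [Finset.sum_insert hw, if_pos rfl, Finset.sum_congr rfl fun x hx =>
        if_neg (ne_of_mem_of_not_mem hx hw), hcard]
      ring
    · rw [Finset.sum_insert hw, hy]
      simp only [if_true]
      congr 1
      exact Finset.sum_congr rfl fun x hx => by rw [if_neg (ne_of_mem_of_not_mem hx hw)]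
  have hyw' : y = (ε * κ) • w' + ∑ x ∈ s, ((1 - ε) * (s.card : ℝ)⁻¹ + ε * g x) • x := by
    have : w = κ • w' + ∑ x ∈ s, g x • x := by rw [hg]; abel
    rw [hy, this]
    simp only [add_smul, Finset.sum_add_distrib, smul_add, smul_smul, Finset.smul_sum]
    abel
  have hone : ∀ v ∈ convexHull ℝ ((insert w s : Finset (ι → ℝ)) : Set (ι → ℝ)),
      ∑ i, v i = 1 := fun v hv => (hK ▸ convexHull_subset_space hws hv : v ∈ stdSimplex ℝ ι).2
  have hy2 : y ∈ convexHull ℝ ((insert w' s : Finset (ι → ℝ)) : Set (ι → ℝ)) := by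
    refine Finset.mem_convexHull'.2
      ⟨fun x => if x = w' then ε * κ else (1 - ε) * (s.card : ℝ)⁻¹ + ε * g x, ?_, ?_, ?_⟩
    · intro x hx
      dsimp only
      split_ifs with hxw
      · exact (mul_pos hε0 hκ).le
      · exact hεs x ((Finset.mem_insert.1 hx).resolve_left hxw)
    -- That the weights sum to 1 is read off from the coordinate sum of `y`, since every vertex has
    -- coordinate sum 1.
    · have h1 := hone y hy1
      rw [hyw'] at h1
      simp only [Pi.add_apply, Pi.smul_apply, Finset.sum_apply, smul_eq_mul,
        Finset.sum_add_distrib] at h1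
      rw [← Finset.mul_sum, Finset.sum_comm,
        (mem_stdSimplex_of_mem_face hK hws' (Finset.mem_insert_self _ _)).2] at h1
      rw [Finset.sum_insert hw', if_pos rfl]
      refine Eq.trans ?_ h1
      rw [mul_one]
      congr 1
      refine Finset.sum_congr rfl fun x hx => ?_
      rw [if_neg (ne_of_mem_of_not_mem hx hw'), ← Finset.mul_sum,
        (mem_stdSimplex_of_mem_face hK hws (Finset.mem_insert_of_mem hx)).2, mul_one]
    · rw [Finset.sum_insert hw', hyw']
      simp only [if_true]
      congr 1
      exact Finset.sum_congr rfl fun x hx => by rw [if_neg (ne_of_mem_of_not_mem hx hw')]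
  have hy3 := K.inter_subset_convexHull hws hws' ⟨hy1, hy2⟩
  rw [← Finset.coe_inter] at hy3
  have hint : insert w s ∩ insert w' s ⊆ s := by
    intro x hx
    simp only [Finset.mem_inter, Finset.mem_insert] at hx
    rcases hx with ⟨rfl | h1, h2 | h2⟩
    · exact absurd h2 hww
    · exact h2
    · exact h1
    · exact h1
  have hys : y ∈ Submodule.span ℝ (s : Set (ι → ℝ)) :=
    convexHull_min Submodule.subset_span (Submodule.convex _)
      (convexHull_mono (by exact_mod_cast hint) hy3)
  apply hwspan
  refine (Submodule.smul_mem_iff _ hε0.ne').1 ?_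
  have : ε • w = y - ∑ x ∈ s, ((1 - ε) * (s.card : ℝ)⁻¹) • x := by rw [hy]; abel
  rw [this]
  exact Submodule.sub_mem _ hys (Submodule.sum_mem _ fun x hx =>
    Submodule.smul_mem _ _ (Submodule.subset_span hx))

/-- The barycenter of a face. -/
noncomputable def barycenter (s : Finset (ι → ℝ)) : ι → ℝ := ∑ x ∈ s, (s.card : ℝ)⁻¹ • x

omit [Fintype ι] in
theorem barycenter_apply (s : Finset (ι → ℝ)) (i : ι) :
    barycenter s i = (s.card : ℝ)⁻¹ * ∑ x ∈ s, x i := by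
  simp [barycenter, Finset.sum_apply, Finset.mul_sum]

omit [Fintype ι] in
theorem barycenter_mem_span (s : Finset (ι → ℝ)) :
    barycenter s ∈ Submodule.span ℝ (s : Set (ι → ℝ)) :=
  Submodule.sum_mem _ fun _ hx => Submodule.smul_mem _ _ (Submodule.subset_span hx)

omit [Fintype ι] in
theorem sum_inv_card {s : Finset (ι → ℝ)} (hs : s.Nonempty) :
    ∑ _x ∈ s, (s.card : ℝ)⁻¹ = 1 := by
  rw [Finset.sum_const, nsmul_eq_mul, mul_inv_cancel₀]
  exact_mod_cast hs.card_pos.ne'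

theorem barycenter_mem_stdSimplex (hK : K.space = stdSimplex ℝ ι) {s : Finset (ι → ℝ)}
    (hs : s ∈ K.faces) : barycenter s ∈ stdSimplex ℝ ι :=
  hK ▸ convexHull_subset_space hs (Finset.mem_convexHull'.2
    ⟨fun _ => (s.card : ℝ)⁻¹, fun _ _ => by positivity,
      sum_inv_card (nonempty_of_mem_faces hs), rfl⟩)

theorem eventually_barycenter_add_mem [DecidableEq ι] (hK : K.space = stdSimplex ℝ ι)
    {s : Finset (ι → ℝ)} (hs : s ∈ K.faces) (j : ι) :
    ∀ᶠ ε : ℝ in nhdsWithin 0 (Set.Ioi 0),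
      barycenter s + ε • (Pi.single j 1 - barycenter s) ∈ stdSimplex ℝ ι := by
  have h1 : ∀ᶠ ε : ℝ in nhdsWithin 0 (Set.Ioi 0), ε < 1 :=
    (eventually_lt_nhds one_pos).filter_mono nhdsWithin_le_nhds
  filter_upwards [h1, self_mem_nhdsWithin] with ε h1 h0
  have h0 : 0 < ε := h0
  have := convex_stdSimplex ℝ ι (barycenter_mem_stdSimplex hK hs)
    (single_mem_stdSimplex ℝ j) (sub_nonneg.2 h1.le) h0.le (by ring)
  convert this using 1
  rw [sub_smul, one_smul, smul_sub]
  abel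

theorem eventually_barycenter_sub_mem [DecidableEq ι] (hK : K.space = stdSimplex ℝ ι)
    {s : Finset (ι → ℝ)} (hs : s ∈ K.faces) {j : ι} (hj : 0 < barycenter s j) :
    ∀ᶠ ε : ℝ in nhdsWithin 0 (Set.Ioi 0),
      barycenter s + ε • (-(Pi.single j 1 - barycenter s)) ∈ stdSimplex ℝ ι := by
  have h1 : ∀ᶠ ε : ℝ in nhdsWithin 0 (Set.Ioi 0), ε < barycenter s j :=
    (eventually_lt_nhds hj).filter_mono nhdsWithin_le_nhds
  filter_upwards [h1, self_mem_nhdsWithin] with ε h1 h0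
  have h0 : 0 < ε := h0
  have hb := barycenter_mem_stdSimplex hK hs
  refine ⟨fun i => ?_, ?_⟩
  · have hi := hb.1 i
    rcases eq_or_ne i j with rfl | hij
    · simp only [Pi.add_apply, Pi.smul_apply, Pi.neg_apply, Pi.sub_apply, Pi.single_eq_same,
        smul_eq_mul]
      nlinarith
    · simp only [Pi.add_apply, Pi.smul_apply, Pi.neg_apply, Pi.sub_apply,
        Pi.single_eq_of_ne hij, smul_eq_mul]
      nlinarith
  · simp only [Pi.add_apply, Pi.smul_apply, Pi.neg_apply, Pi.sub_apply, smul_eq_mul,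
      Finset.sum_add_distrib, ← Finset.mul_sum, Finset.sum_neg_distrib, Finset.sum_sub_distrib,
      hb.2]
    simp

/-- A codimension one simplex in the boundary of the face spanned by `I` has a unique coface
there. -/
theorem existsUnique_coface (hK : K.space = stdSimplex ℝ ι) (hfin : K.faces.Finite)
    {s : Finset (ι → ℝ)} [DecidableEq (ι → ℝ)] {I : Finset ι} (hs : s ∈ K.faces)
    (hI : ∀ x ∈ s, ∀ i ∉ I, x i = 0) (hc : s.card + 1 = I.card) {j : ι} (hjI : j ∈ I)
    (hj : ∀ x ∈ s, x j = 0) :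
    ∃! w, w ∉ s ∧ insert w s ∈ K.faces ∧ ∀ i ∉ I, w i = 0 := by
  classical
  have hne := nonempty_of_mem_faces hs
  -- The `j`-th coordinate is 1 on `u` and 0 on `span s`. It is nonnegative on the big simplex, so
  -- every coface lies on the side of `u`.
  set u : ι → ℝ := Pi.single j 1 - barycenter s with hu
  have hspan : ∀ z ∈ Submodule.span ℝ (s : Set (ι → ℝ)), z j = 0 := by
    intro z hz
    have : Submodule.span ℝ (s : Set (ι → ℝ)) ≤ LinearMap.ker (LinearMap.proj (R := ℝ) j) :=
      Submodule.span_le.2 fun x hx => by simpa using hj x hx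
    simpa using this hz
  have huj : u j = 1 := by
    simp [hu, hspan _ (barycenter_mem_span s)]
  have husp : u ∉ Submodule.span ℝ (s : Set (ι → ℝ)) := fun h => by
    have := hspan u h
    rw [huj] at this
    exact one_ne_zero this
  have huI : ∀ i ∉ I, u i = 0 := by
    intro i hi
    have hij : i ≠ j := fun e => hi (e ▸ hjI)
    simp [hu, barycenter_apply, hij, Finset.sum_eq_zero fun x hx => hI x hx i hi]
  obtain ⟨w, hw, hws, hwI, c, hc0, hcw⟩ := exists_coface hK hfin hs hI hc
    (a := fun _ => (s.card : ℝ)⁻¹)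
    (fun _ _ => inv_pos.2 (by exact_mod_cast hne.card_pos)) (sum_inv_card hne) huI husp
    (eventually_barycenter_add_mem hK hs j)
  refine ⟨w, ⟨hw, hws, hwI⟩, ?_⟩
  rintro w' ⟨hw', hws', hwI'⟩
  obtain ⟨c', hc'⟩ := mem_span_insert_of_card (linearIndepOn_face hK hs) hI hc husp huI hwI'
  have hwj : w' j = c' := by
    have := hspan _ hc'
    simp only [Pi.sub_apply, Pi.smul_apply, huj, smul_eq_mul, mul_one] at this
    linarith
  have h0 : 0 ≤ c' :=
    hwj ▸ (mem_stdSimplex_of_mem_face hK hws' (Finset.mem_insert_self _ _)).1 j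
  have hne0 : c' ≠ 0 := by
    rintro rfl
    exact notMem_span_of_insert hK hw' hws' (by simpa using hc')
  exact coface_unique hK hne hw' hws' hw hws (lt_of_le_of_ne h0 hne0.symm) hc0 hc' hcw

/-- A codimension one simplex in the interior of the face spanned by `I` has exactly two cofaces
there. -/
theorem exists_two_cofaces (hK : K.space = stdSimplex ℝ ι) (hfin : K.faces.Finite)
    {s : Finset (ι → ℝ)} [DecidableEq (ι → ℝ)] {I : Finset ι} (hs : s ∈ K.faces)
    (hI : ∀ x ∈ s, ∀ i ∉ I, x i = 0) (hc : s.card + 1 = I.card)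
    (hint : ∀ j ∈ I, ∃ x ∈ s, x j ≠ 0) :
    ∃ w₁ w₂, w₁ ≠ w₂ ∧
      ∀ w, (w ∉ s ∧ insert w s ∈ K.faces ∧ ∀ i ∉ I, w i = 0) ↔ w = w₁ ∨ w = w₂ := by
  classical
  have hne := nonempty_of_mem_faces hs
  have hcard : (0 : ℝ) < (s.card : ℝ)⁻¹ := inv_pos.2 (by exact_mod_cast hne.card_pos)
  -- The direction towards such a corner is transversal to `s`. The barycenter has positive `j`-th
  -- coordinate, so the opposite direction also stays in the simplex, and each side supplies one
  -- coface.
  obtain ⟨j, hjI, hj⟩ := exists_single_notMem_span (s := s) (I := I) (by omega)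
  set u : ι → ℝ := Pi.single j 1 - barycenter s with hu
  have husp : u ∉ Submodule.span ℝ (s : Set (ι → ℝ)) := fun h => hj (by
    have := Submodule.add_mem _ h (barycenter_mem_span s)
    rwa [hu, sub_add_cancel] at this)
  have hnusp : -u ∉ Submodule.span ℝ (s : Set (ι → ℝ)) := fun h => husp (by
    simpa using Submodule.neg_mem _ h)
  have huI : ∀ i ∉ I, u i = 0 := by
    intro i hi
    have hij : i ≠ j := fun e => hi (e ▸ hjI)
    simp [hu, barycenter_apply, hij, Finset.sum_eq_zero fun x hx => hI x hx i hi]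
  have hpos : 0 < barycenter s j := by
    rw [barycenter_apply]
    obtain ⟨x, hx, hxj⟩ := hint j hjI
    have hnn := fun y (hy : y ∈ s) => (mem_stdSimplex_of_mem_face hK hs hy).1 j
    exact mul_pos hcard (Finset.sum_pos' hnn ⟨x, hx, lt_of_le_of_ne (hnn x hx) hxj.symm⟩)
  obtain ⟨w₁, hw₁, hws₁, hwI₁, c₁, hc₁, hcw₁⟩ := exists_coface hK hfin hs hI hc
    (a := fun _ => (s.card : ℝ)⁻¹) (fun _ _ => hcard) (sum_inv_card hne) huI husp
    (eventually_barycenter_add_mem hK hs j)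
  obtain ⟨w₂, hw₂, hws₂, hwI₂, c₂, hc₂, hcw₂⟩ := exists_coface hK hfin hs hI hc
    (a := fun _ => (s.card : ℝ)⁻¹) (fun _ _ => hcard) (sum_inv_card hne) (u := -u)
    (fun i hi => by simp [huI i hi]) hnusp (eventually_barycenter_sub_mem hK hs hpos)
  refine ⟨w₁, w₂, ?_, fun w => ⟨?_, ?_⟩⟩
  · rintro rfl
    have h := Submodule.sub_mem _ hcw₂ hcw₁
    have h' : (w₁ - c₂ • -u) - (w₁ - c₁ • u) = (c₁ + c₂) • u := by
      rw [smul_neg, add_smul]; abel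
    rw [h'] at h
    exact husp ((Submodule.smul_mem_iff _ (by positivity)).1 h)
  · rintro ⟨hw, hws, hwI⟩
    obtain ⟨c, hcw⟩ := mem_span_insert_of_card (linearIndepOn_face hK hs) hI hc husp huI hwI
    rcases lt_trichotomy c 0 with hneg | rfl | hcpos
    · exact Or.inr (coface_unique hK hne hw hws hw₂ hws₂ (neg_pos.2 hneg) hc₂
        (by simpa using hcw) hcw₂)
    · exact absurd (by simpa using hcw) (notMem_span_of_insert hK hw hws)
    · exact Or.inl (coface_unique hK hne hw hws hw₁ hws₁ hcpos hc₁ hcw hcw₁)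
  · rintro (rfl | rfl)
    · exact ⟨hw₁, hws₁, hwI₁⟩
    · exact ⟨hw₂, hws₂, hwI₂⟩

/-- The corners of the simplex are vertices of the triangulation. -/
theorem single_mem_vertices [DecidableEq ι] (hK : K.space = stdSimplex ℝ ι) (j : ι) :
    (Pi.single j 1 : ι → ℝ) ∈ K.vertices := by
  obtain ⟨s, hs, hm⟩ := mem_space_iff.1 (hK ▸ single_mem_stdSimplex ℝ j : Pi.single j 1 ∈ K.space)
  suffices h : (Pi.single j 1 : ι → ℝ) ∈ s from
    K.down_closed hs (Finset.singleton_subset_iff.2 h) (Finset.singleton_nonempty _)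
  obtain ⟨b, hb, hb1, hbs⟩ := Finset.mem_convexHull'.1 hm
  obtain ⟨x, hx, hbx⟩ : ∃ x ∈ s, b x ≠ 0 := by
    by_contra! hcon
    rw [Finset.sum_eq_zero hcon] at hb1
    exact zero_ne_one hb1
  have hxs := mem_stdSimplex_of_mem_face hK hs hx
  have h0 : ∀ i, i ≠ j → x i = 0 := by
    intro i hi
    have h1 := congrFun hbs i
    simp only [Finset.sum_apply, Pi.smul_apply, smul_eq_mul, Pi.single_eq_of_ne hi] at h1
    have h2 := (Finset.sum_eq_zero_iff_of_nonneg fun y hy =>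
      mul_nonneg (hb y hy) ((mem_stdSimplex_of_mem_face hK hs hy).1 i)).1 h1 x hx
    exact (mul_eq_zero.1 h2).resolve_left hbx
  have hxj : x = Pi.single j 1 := by
    funext i
    rcases eq_or_ne i j with rfl | hi
    · have := hxs.2
      rw [Finset.sum_eq_single i (fun k _ hk => h0 k hk) (by simp)] at this
      simpa using this
    · rw [h0 i hi, Pi.single_eq_of_ne hi]
  exact hxj ▸ hx

end Geometry.SimplicialComplex

end Geometry

/-! ### Combinatorial triangulated simplices and Sperner's lemma. -/

section Sperner

variable {V ι : Type*} [Fintype V] [DecidableEq V] [DecidableEq ι]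

/-- The vertices that extend the simplex `s` to a simplex of `F` within the face `I`. -/
def extensions (F : Finset (Finset V)) (supp : V → Finset ι) (I : Finset ι) (s : Finset V) :
    Finset V :=
  {w | w ∉ s ∧ insert w s ∈ F ∧ supp w ⊆ I}

/-- The combinatorial structure of a triangulated simplex with corners indexed by `ι`: `F` are the
simplices, and `supp v` spans the smallest face of the big simplex that contains the vertex `v`. -/
structure IsTriangulatedSimplex (F : Finset (Finset V)) (supp : V → Finset ι) : Prop where
  nonempty : ∀ s ∈ F, s.Nonempty
  down : ∀ s ∈ F, ∀ t ⊆ s, t.Nonempty → t ∈ F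
  corner : ∀ i, ∃ v, {v} ∈ F ∧ ∀ w, supp w ⊆ {i} ↔ w = v
  card_extensions_boundary : ∀ I, ∀ s ∈ F, (∀ v ∈ s, supp v ⊆ I) → s.card + 1 = I.card →
    (∃ j ∈ I, ∀ v ∈ s, j ∉ supp v) → (extensions F supp I s).card = 1
  card_extensions_interior : ∀ I, ∀ s ∈ F, (∀ v ∈ s, supp v ⊆ I) → s.card + 1 = I.card →
    (¬ ∃ j ∈ I, ∀ v ∈ s, j ∉ supp v) → (extensions F supp I s).card = 2

/-- The simplices of full dimension in the face `I`. -/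
def fullSimplices (F : Finset (Finset V)) (supp : V → Finset ι) (I : Finset ι) :
    Finset (Finset V) :=
  {s ∈ F | (∀ v ∈ s, supp v ⊆ I) ∧ s.card = I.card}

theorem mem_extensions {F : Finset (Finset V)} {supp : V → Finset ι} {I : Finset ι}
    {s : Finset V} {w : V} :
    w ∈ extensions F supp I s ↔ w ∉ s ∧ insert w s ∈ F ∧ supp w ⊆ I := by
  simp [extensions]

theorem mem_fullSimplices {F : Finset (Finset V)} {supp : V → Finset ι} {I : Finset ι}
    {s : Finset V} :
    s ∈ fullSimplices F supp I ↔ s ∈ F ∧ (∀ v ∈ s, supp v ⊆ I) ∧ s.card = I.card := by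
  simp [fullSimplices]

/-- Double counting of pairs of a simplex in `S` and a full simplex of `I` obtained by adding one
vertex. -/
theorem sum_card_extensions {F : Finset (Finset V)} {supp : V → Finset ι} {I : Finset ι}
    {S : Finset (Finset V)} (hS : ∀ s ∈ S, (∀ v ∈ s, supp v ⊆ I) ∧ s.card + 1 = I.card) :
    ∑ s ∈ S, (extensions F supp I s).card =
      ∑ t ∈ fullSimplices F supp I, ({w ∈ t | t.erase w ∈ S}).card := by
  rw [← Finset.card_sigma, ← Finset.card_sigma]
  refine Finset.card_bij' (fun x _ => ⟨insert x.2 x.1, x.2⟩) (fun x _ => ⟨x.1.erase x.2, x.2⟩)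
    ?_ ?_ ?_ ?_
  · rintro ⟨s, w⟩ h
    obtain ⟨hs, h⟩ := Finset.mem_sigma.1 h
    obtain ⟨hw, hF, hI⟩ := mem_extensions.1 h
    obtain ⟨h1, h2⟩ := hS s hs
    refine Finset.mem_sigma.2 ⟨mem_fullSimplices.2 ⟨hF, ?_, ?_⟩, ?_⟩
    · intro v hv
      rcases Finset.mem_insert.1 hv with rfl | hv
      · exact hI
      · exact h1 v hv
    · rw [Finset.card_insert_of_notMem hw, h2]
    · exact Finset.mem_filter.2 ⟨Finset.mem_insert_self _ _, by simpa [Finset.erase_insert hw] using hs⟩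
  · rintro ⟨t, w⟩ h
    obtain ⟨ht, h⟩ := Finset.mem_sigma.1 h
    obtain ⟨hF, hI, hc⟩ := mem_fullSimplices.1 ht
    obtain ⟨hw, hS'⟩ := Finset.mem_filter.1 h
    exact Finset.mem_sigma.2 ⟨hS', mem_extensions.2
      ⟨Finset.notMem_erase _ _, by rwa [Finset.insert_erase hw], hI w hw⟩⟩
  · rintro ⟨s, w⟩ h
    obtain ⟨hs, h⟩ := Finset.mem_sigma.1 h
    simp [Finset.erase_insert (mem_extensions.1 h).1]
  · rintro ⟨t, w⟩ h
    obtain ⟨ht, h⟩ := Finset.mem_sigma.1 h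
    simp [Finset.insert_erase (Finset.mem_filter.1 h).1]

/-- The parity of the degree sum is that of the number of simplices in the boundary. -/
theorem IsTriangulatedSimplex.sum_card_extensions_modEq {F : Finset (Finset V)}
    {supp : V → Finset ι} (hF : IsTriangulatedSimplex F supp) {I : Finset ι}
    {S : Finset (Finset V)}
    (hS : ∀ s ∈ S, s ∈ F ∧ (∀ v ∈ s, supp v ⊆ I) ∧ s.card + 1 = I.card) :
    ((∑ s ∈ S, (extensions F supp I s).card : ℕ) : ZMod 2) =
      (({s ∈ S | ∃ j ∈ I, ∀ v ∈ s, j ∉ supp v}).card : ZMod 2) := by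
  rw [Nat.cast_sum, Finset.card_filter, Nat.cast_sum]
  refine Finset.sum_congr rfl fun s hs => ?_
  obtain ⟨h1, h2, h3⟩ := hS s hs
  split_ifs with h
  · rw [hF.card_extensions_boundary I s h1 h2 h3 h]
  · rw [hF.card_extensions_interior I s h1 h2 h3 h]
    rfl

omit [Fintype V] in
/-- A simplex with one vertex more than there are colors has two facets with all colors. -/
theorem card_doors_of_image_eq {c : V → ι} {J : Finset ι} {t : Finset V}
    (hc : t.card = J.card + 1) (h : t.image c = J) :
    ({w ∈ t | (t.erase w).image c = J}).card = 2 := by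
  obtain ⟨u, hu, w, hw, huw, hcuw⟩ := Finset.exists_ne_map_eq_of_card_lt_of_maps_to
    (s := t) (t := J) (f := c) (by omega) (fun x hx => h ▸ Finset.mem_image_of_mem c hx)
  have key : ∀ u ∈ t, ∀ w ∈ t, u ≠ w → c u = c w → (t.erase u).image c = J := by
    intro u hu w hw huw hcuw
    rw [← h]
    refine (Finset.image_subset_image (Finset.erase_subset _ _)).antisymm fun k hk => ?_
    obtain ⟨x, hx, rfl⟩ := Finset.mem_image.1 hk
    by_cases hxu : x = u
    · exact Finset.mem_image.2 ⟨w, Finset.mem_erase.2 ⟨huw.symm, hw⟩, by rw [hxu, hcuw]⟩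
    · exact Finset.mem_image_of_mem c (Finset.mem_erase.2 ⟨hxu, hx⟩)
  rw [Finset.card_eq_two]
  refine ⟨u, w, huw, ?_⟩
  ext x
  simp only [Finset.mem_filter, Finset.mem_insert, Finset.mem_singleton]
  constructor
  · rintro ⟨hx, hxJ⟩
    by_contra! hne
    have hinj : Set.InjOn c (t.erase x) := by
      rw [← Finset.card_image_iff, hxJ, Finset.card_erase_of_mem hx]
      omega
    exact huw (hinj (by simp [hu, hne.1.symm]) (by simp [hw, hne.2.symm]) hcuw)
  · rintro (rfl | rfl)
    · exact ⟨hu, key _ hu _ hw huw hcuw⟩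
    · exact ⟨hw, key _ hw _ hu huw.symm hcuw.symm⟩

-- The coloring is injective on `t`, so only the removal of the vertex colored `i` leaves the colors
-- `J`.
omit [Fintype V] in
theorem card_doors_of_image_eq_insert {c : V → ι} {J : Finset ι} {i : ι} (hi : i ∉ J)
    {t : Finset V} (hc : t.card = J.card + 1) (h : t.image c = insert i J) :
    ({w ∈ t | (t.erase w).image c = J}).card = 1 := by
  have hinj : Set.InjOn c t := by
    rw [← Finset.card_image_iff, h, Finset.card_insert_of_notMem hi, hc]
  obtain ⟨u, hu, hcu⟩ := Finset.mem_image.1 (h ▸ Finset.mem_insert_self i J : i ∈ t.image c)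
  rw [Finset.card_eq_one]
  refine ⟨u, ?_⟩
  ext x
  simp only [Finset.mem_filter, Finset.mem_singleton]
  constructor
  · rintro ⟨hx, hxJ⟩
    by_contra hne
    apply hi
    rw [← hxJ, ← hcu]
    exact Finset.mem_image_of_mem c (Finset.mem_erase.2 ⟨fun e => hne e.symm, hu⟩)
  · rintro rfl
    refine ⟨hu, ?_⟩
    ext k
    constructor
    · intro hk
      obtain ⟨y, hy, rfl⟩ := Finset.mem_image.1 hk
      obtain ⟨hyx, hyt⟩ := Finset.mem_erase.1 hy
      refine (Finset.mem_insert.1 (h ▸ Finset.mem_image_of_mem c hyt)).resolve_left fun e => hyx ?_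
      exact hinj hyt hu (e.trans hcu.symm)
    · intro hk
      obtain ⟨y, hy, rfl⟩ := Finset.mem_image.1 (h ▸ Finset.mem_insert_of_mem hk : k ∈ t.image c)
      refine Finset.mem_image_of_mem c (Finset.mem_erase.2 ⟨?_, hy⟩)
      rintro rfl
      exact hi (hcu ▸ hk)

omit [Fintype V] in
theorem doors_eq_empty_of_not_subset {c : V → ι} {J : Finset ι} {t : Finset V}
    (h : ¬ J ⊆ t.image c) : {w ∈ t | (t.erase w).image c = J} = ∅ := by
  refine Finset.filter_eq_empty_iff.2 fun w _ hwJ => h ?_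
  rw [← hwJ]
  exact Finset.image_subset_image (Finset.erase_subset _ _)

/-- **Sperner's lemma**: the number of panchromatic simplices is odd. -/
theorem IsTriangulatedSimplex.odd_card_panchromatic {F : Finset (Finset V)} {supp : V → Finset ι}
    (hF : IsTriangulatedSimplex F supp) (c : V → ι) (I : Finset ι) (hI : I.Nonempty)
    (hc : ∀ v, supp v ⊆ I → c v ∈ supp v) :
    ((({s ∈ fullSimplices F supp I | s.image c = I}).card : ℕ) : ZMod 2) = 1 := by
  induction hI using Finset.Nonempty.cons_induction with
  | singleton i =>
    obtain ⟨v, hv, hw⟩ := hF.corner i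
    have hvi := (hw v).2 rfl
    have hcv : c v = i := by simpa using hvi (hc v hvi)
    have : {s ∈ fullSimplices F supp {i} | s.image c = {i}} = {{v}} := by
      ext s
      simp only [Finset.mem_filter, mem_fullSimplices, Finset.mem_singleton,
        Finset.card_singleton]
      constructor
      · rintro ⟨⟨-, h2, h3⟩, -⟩
        obtain ⟨x, rfl⟩ := Finset.card_eq_one.1 h3
        rw [(hw x).1 (h2 x (Finset.mem_singleton_self x))]
      · rintro rfl
        refine ⟨⟨hv, ?_, rfl⟩, by simp [hcv]⟩
        intro x hx
        rw [Finset.mem_singleton.1 hx]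
        exact hvi
    simp [this]
  | cons i J hi hJ ih =>
    have ih := ih fun v hv => hc v (hv.trans (Finset.subset_cons hi))
    rw [Finset.cons_eq_insert] at hc ⊢
    have hcard : (insert i J).card = J.card + 1 := Finset.card_insert_of_notMem hi
    set S : Finset (Finset V) :=
      {s ∈ F | (∀ v ∈ s, supp v ⊆ insert i J) ∧ s.card = J.card ∧ s.image c = J} with hSdef
    have hS : ∀ s ∈ S, s ∈ F ∧ (∀ v ∈ s, supp v ⊆ insert i J) ∧
        s.card + 1 = (insert i J).card := by
      intro s hs
      obtain ⟨h1, h2, h3, -⟩ := Finset.mem_filter.1 hs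
      exact ⟨h1, h2, by omega⟩
    have h1 := hF.sum_card_extensions_modEq hS
    rw [sum_card_extensions fun s hs => (hS s hs).2] at h1
    -- A simplex with all colors of `J` cannot lie opposite to a corner of `J`, as a color occurs
    -- only where it is in the support. Its only possible boundary facet is the one opposite to `i`.
    have hbd : {s ∈ S | ∃ j ∈ insert i J, ∀ v ∈ s, j ∉ supp v} =
        {s ∈ fullSimplices F supp J | s.image c = J} := by
      ext s
      simp only [hSdef, Finset.mem_filter, mem_fullSimplices]
      constructor
      · rintro ⟨⟨g1, h2, h3, h4⟩, j, hj, hjs⟩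
        have hji : j = i := by
          refine (Finset.mem_insert.1 hj).resolve_right fun hjJ => ?_
          rw [← h4] at hjJ
          obtain ⟨v, hv, rfl⟩ := Finset.mem_image.1 hjJ
          exact hjs v hv (hc v (h2 v hv))
        subst hji
        exact ⟨⟨g1, fun v hv k hk => (Finset.mem_insert.1 (h2 v hv hk)).resolve_left
          fun e => hjs v hv (e ▸ hk), h3⟩, h4⟩
      · rintro ⟨⟨h1, h2, h3⟩, h4⟩
        exact ⟨⟨h1, fun v hv => (h2 v hv).trans (Finset.subset_insert _ _), h3, h4⟩,
          i, Finset.mem_insert_self _ _, fun v hv h => hi (h2 v hv h)⟩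
    rw [hbd, ih] at h1
    rw [← h1, Finset.card_filter, Nat.cast_sum, Nat.cast_sum]
    refine Finset.sum_congr rfl fun t ht => ?_
    obtain ⟨ht1, ht2, ht3⟩ := mem_fullSimplices.1 ht
    rw [hcard] at ht3
    have hfil : {w ∈ t | t.erase w ∈ S} = {w ∈ t | (t.erase w).image c = J} := by
      refine Finset.filter_congr fun w hw => ?_
      simp only [hSdef, Finset.mem_filter]
      refine ⟨fun h => h.2.2.2, fun h => ?_⟩
      have hcw : (t.erase w).card = J.card := by rw [Finset.card_erase_of_mem hw]; omega
      refine ⟨hF.down t ht1 _ (Finset.erase_subset _ _) ?_,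
        fun v hv => ht2 v (Finset.mem_of_mem_erase hv), hcw, h⟩
      rw [← Finset.card_pos, hcw]
      exact hJ.card_pos
    rw [hfil]
    have himg : t.image c ⊆ insert i J := by
      intro k hk
      obtain ⟨v, hv, rfl⟩ := Finset.mem_image.1 hk
      exact ht2 v hv (hc v (ht2 v hv))
    -- Panchromatic simplices have one door, simplices colored exactly by `J` have two, all others
    -- none.
    by_cases hti : t.image c = insert i J
    · rw [card_doors_of_image_eq_insert hi ht3 hti, if_pos hti]
    by_cases htJ : t.image c = J
    · rw [card_doors_of_image_eq ht3 htJ, if_neg hti]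
      rfl
    · rw [doors_eq_empty_of_not_subset, if_neg hti]
      · simp
      · intro hsub
        by_cases him : i ∈ t.image c
        · exact hti (himg.antisymm (Finset.insert_subset him hsub))
        · exact htJ (Finset.Subset.antisymm (fun k hk =>
            (Finset.mem_insert.1 (himg hk)).resolve_left fun e => him (e ▸ hk)) hsub)

/-! ### Walks through doors. -/

variable [Fintype ι]

/-- The facets in which all colors but `j` occur. -/
abbrev Door (F : Finset (Finset V)) (c : V → ι) (j : ι) : Type _ :=
  {s : Finset V // s ∈ F ∧ s.card + 1 = Fintype.card ι ∧ s.image c = Finset.univ.erase j}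

/-- Two doors are adjacent if they are facets of a common simplex. -/
def doorGraph (F : Finset (Finset V)) (c : V → ι) (j : ι) : SimpleGraph (Door F c j) where
  Adj s t := s ≠ t ∧ ∃ r ∈ F, r.card = Fintype.card ι ∧ s.1 ⊆ r ∧ t.1 ⊆ r
  symm := ⟨fun _ _ ⟨h, r, hr, hc, h1, h2⟩ => ⟨h.symm, r, hr, hc, h2, h1⟩⟩
  loopless := ⟨fun _ h => h.1 rfl⟩

theorem card_door_le (F : Finset (Finset V)) (c : V → ι) (j : ι) :
    Nat.card (Door F c j) ≤ Fintype.card V ^ (Fintype.card ι - 1) := by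
  classical
  rw [Nat.card_eq_fintype_card]
  refine le_trans ?_ (Nat.choose_le_pow _ _)
  rw [← Finset.card_univ (α := V), ← Finset.card_powersetCard, ← Fintype.card_coe]
  refine Fintype.card_le_of_injective
    (fun s => ⟨s.1, Finset.mem_powersetCard.2 ⟨Finset.subset_univ _, by have := s.2.2.1; omega⟩⟩) ?_
  intro s t h
  exact Subtype.ext (congrArg (fun a => a.1) h)

/-- Otherwise let `S` be the doors reachable from the facet opposite to `j`. Its boundary members
would be exactly the doors in that facet, an odd number by Sperner's lemma there. But `S` is closed
under adjacency, so every full simplex has zero or two facets in `S`, which makes this number even.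
-/
theorem IsTriangulatedSimplex.exists_reachable_doors {F : Finset (Finset V)} {supp : V → Finset ι}
    (hF : IsTriangulatedSimplex F supp) {i j : ι} (hij : i ≠ j) (c : V → ι)
    (hcj : ∀ v, c v ≠ j) (hc : ∀ v, c v ≠ i → c v ∈ supp v)
    (hci : ∀ v, c v = i → i ∈ supp v ∨ j ∈ supp v) :
    ∃ s t : Door F c j, (∀ v ∈ s.1, j ∉ supp v) ∧ (∀ v ∈ t.1, i ∉ supp v) ∧
      (doorGraph F c j).Reachable s t := by
  classical
  by_contra! hno
  set J : Finset ι := Finset.univ.erase j with hJ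
  have hJne : J.Nonempty := ⟨i, by simp [hJ, hij]⟩
  have hJc : J.card + 1 = Fintype.card ι := by
    rw [hJ, Finset.card_erase_add_one (Finset.mem_univ j), Finset.card_univ]
  have hodd := hF.odd_card_panchromatic c J hJne fun v hv => by
    by_cases h : c v = i
    · rw [h]
      exact (hci v h).resolve_right fun hj => by simpa [hJ] using hv hj
    · exact hc v h
  set S : Finset (Finset V) := {s ∈ F | ∃ t : Door F c j, t.1 = s ∧
    ∃ s₀ : Door F c j, (∀ v ∈ s₀.1, j ∉ supp v) ∧ (doorGraph F c j).Reachable s₀ t} with hSdef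
  have hS : ∀ s ∈ S, s ∈ F ∧ (∀ v ∈ s, supp v ⊆ Finset.univ) ∧
      s.card + 1 = (Finset.univ : Finset ι).card := by
    intro s hs
    obtain ⟨h1, t, rfl, -⟩ := Finset.mem_filter.1 hs
    exact ⟨h1, fun v _ => Finset.subset_univ _, by rw [t.2.2.1, Finset.card_univ]⟩
  have h1 := hF.sum_card_extensions_modEq hS
  rw [sum_card_extensions fun s hs => (hS s hs).2] at h1
  have hbd : {s ∈ S | ∃ k ∈ Finset.univ, ∀ v ∈ s, k ∉ supp v} =
      {s ∈ fullSimplices F supp J | s.image c = J} := by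
    ext s
    simp only [hSdef, Finset.mem_filter, mem_fullSimplices]
    constructor
    · rintro ⟨⟨h1, t, rfl, s₀, hs₀, hr⟩, k, -, hk⟩
      have hkj : k = j := by
        by_contra hkj
        have hkJ : k ∈ t.1.image c := by rw [t.2.2.2]; simp [hkj]
        obtain ⟨v, hv, hvk⟩ := Finset.mem_image.1 hkJ
        by_cases hki : k = i
        · exact hno s₀ t hs₀ (hki ▸ hk) hr
        · exact hk v hv (hvk ▸ hc v (hvk ▸ hki))
      subst hkj
      have := t.2.2.1
      exact ⟨⟨h1, fun v hv l hl => Finset.mem_erase.2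
        ⟨fun e => hk v hv (e ▸ hl), Finset.mem_univ _⟩, by omega⟩, t.2.2.2⟩
    · rintro ⟨⟨h1, h2, h3⟩, h4⟩
      have hjs : ∀ v ∈ s, j ∉ supp v := fun v hv h => by simpa [hJ] using h2 v hv h
      exact ⟨⟨h1, ⟨s, h1, by omega, h4⟩, rfl, ⟨s, h1, by omega, h4⟩, hjs,
        SimpleGraph.Reachable.refl _⟩, j, Finset.mem_univ _, hjs⟩
  have h1 := h1.trans (b := _) (c := 1) (by
    rw [← hodd, ← hbd]
    congr!)
  rw [Nat.cast_sum] at h1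
  refine zero_ne_one (α := ZMod 2) (Eq.trans (Eq.symm ?_) h1)
  refine Finset.sum_eq_zero fun t ht => ?_
  obtain ⟨ht1, -, ht3⟩ := mem_fullSimplices.1 ht
  rw [Finset.card_univ] at ht3
  have hdoor : ∀ w ∈ t, (t.erase w).image c = J →
      t.erase w ∈ F ∧ (t.erase w).card + 1 = Fintype.card ι ∧ (t.erase w).image c = J := by
    intro w hw h
    have hcw : (t.erase w).card + 1 = Fintype.card ι := by
      rw [Finset.card_erase_add_one hw, ht3]
    refine ⟨hF.down t ht1 _ (Finset.erase_subset _ _) ?_, hcw, h⟩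
    rw [← Finset.card_pos]
    have := hJne.card_pos
    omega
  rcases Finset.eq_empty_or_nonempty ({w ∈ t | t.erase w ∈ S}) with he | ⟨w, hw⟩
  · simp [he]
  obtain ⟨hwt, hwS⟩ := Finset.mem_filter.1 hw
  obtain ⟨-, s, hs, s₀, hs₀, hr⟩ := Finset.mem_filter.1 hwS
  have htJ : t.image c = J := by
    refine Finset.Subset.antisymm (fun k hk => ?_) ?_
    · obtain ⟨v, -, rfl⟩ := Finset.mem_image.1 hk
      simp [hJ, hcj]
    · rw [show J = s.1.image c from s.2.2.2.symm, hs]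
      exact Finset.image_subset_image (Finset.erase_subset _ _)
  -- The doors of `t` are mutually adjacent through `t`, so with one of them all belong to `S`.
  have hfil : {w ∈ t | t.erase w ∈ S} = {w ∈ t | (t.erase w).image c = J} := by
    refine Finset.filter_congr fun x hx => ⟨fun h => ?_, fun h => ?_⟩
    · obtain ⟨-, s', hs', -⟩ := Finset.mem_filter.1 h
      rw [← hs', s'.2.2.2]
    · have hd := hdoor x hx h
      refine Finset.mem_filter.2 ⟨hd.1, ⟨t.erase x, hd⟩, rfl, s₀, hs₀, hr.trans ?_⟩
      by_cases hsx : s = ⟨t.erase x, hd⟩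
      · rw [hsx]
      · exact SimpleGraph.Adj.reachable ⟨hsx, t, ht1, ht3, hs ▸ Finset.erase_subset _ _,
          Finset.erase_subset _ _⟩
  rw [hfil, card_doors_of_image_eq (by omega) htJ]
  rfl

/-- A walk through doors from the facet opposite to `j` to the facet opposite to `i`. -/
theorem IsTriangulatedSimplex.exists_door_walk {F : Finset (Finset V)} {supp : V → Finset ι}
    (hF : IsTriangulatedSimplex F supp) {i j : ι} (hij : i ≠ j) (c : V → ι)
    (hcj : ∀ v, c v ≠ j) (hc : ∀ v, c v ≠ i → c v ∈ supp v)
    (hci : ∀ v, c v = i → i ∈ supp v ∨ j ∈ supp v) :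
    ∃ q : ℕ → Door F c j, (∀ v ∈ (q 0).1, j ∉ supp v) ∧
      (∀ l, Fintype.card V ^ (Fintype.card ι - 1) ≤ l → ∀ v ∈ (q l).1, i ∉ supp v) ∧
      ∀ l, q l = q (l + 1) ∨ ∃ r ∈ F, r.card = Fintype.card ι ∧ (q l).1 ⊆ r ∧ (q (l + 1)).1 ⊆ r := by
  classical
  obtain ⟨s, t, hs, ht, ⟨p⟩⟩ := hF.exists_reachable_doors hij c hcj hc hci
  have hlen : p.toPath.1.length < Nat.card (Door F c j) := by
    rw [Nat.card_eq_fintype_card]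
    exact p.toPath.2.length_lt
  -- A path is shorter than the number of doors, and `getVert` stays at the endpoint after its end.
  -- This padding is why consecutive doors may be equal.
  refine ⟨p.toPath.1.getVert, by simpa using hs, fun l hl => ?_, fun l => ?_⟩
  · rw [SimpleGraph.Walk.getVert_of_length_le]
    · exact ht
    · exact (hlen.le.trans (card_door_le F c j)).trans hl
  · by_cases hl : l < p.toPath.1.length
    · exact Or.inr (p.toPath.1.adj_getVert_succ hl).2
    · left
      rw [SimpleGraph.Walk.getVert_of_length_le _ (by omega),
        SimpleGraph.Walk.getVert_of_length_le _ (by omega)]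

end Sperner

/-! ### Composition of protocols under a promise. -/

namespace CommProtocol

variable {X Y Z : Type}

/-- The search problem `R`, under the promise `D`, has a protocol with at most `k` bits. -/
def Solvable (D : X → Y → Prop) (R : X → Y → Z → Prop) (k : ℕ) : Prop :=
  ∃ P : CommProtocol X Y Z, P.cost ≤ k ∧ ∀ x y, D x y → R x y (P.run x y)

theorem Solvable.output {D : X → Y → Prop} {R : X → Y → Z → Prop} (z : Z)
    (h : ∀ x y, D x y → R x y z) : Solvable D R 0 :=
  ⟨.output z, le_rfl, h⟩

theorem Solvable.mono {D D' : X → Y → Prop} {R R' : X → Y → Z → Prop} {k l : ℕ}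
    (h : Solvable D R k) (hD : ∀ x y, D' x y → D x y)
    (hR : ∀ x y z, D' x y → R x y z → R' x y z) (hkl : k ≤ l) : Solvable D' R' l := by
  obtain ⟨P, hc, hP⟩ := h
  exact ⟨P, hc.trans hkl, fun x y hxy => hR x y _ hxy (hP x y (hD x y hxy))⟩

theorem Solvable.sendA {D : X → Y → Prop} {R : X → Y → Z → Prop} {k : ℕ} (b : X → Prop)
    (h₁ : Solvable (fun x y => D x y ∧ b x) R k) (h₀ : Solvable (fun x y => D x y ∧ ¬ b x) R k) :
    Solvable D R (k + 1) := by
  classical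
  obtain ⟨P, hP, hP'⟩ := h₀
  obtain ⟨Q, hQ, hQ'⟩ := h₁
  refine ⟨.sendA (fun x => decide (b x)) P Q, by simp [cost, hP, hQ], fun x y hxy => ?_⟩
  by_cases hb : b x
  · simpa [run, hb] using hQ' x y ⟨hxy, hb⟩
  · simpa [run, hb] using hP' x y ⟨hxy, hb⟩

/-- The protocol with the roles of the players exchanged. -/
def swap : CommProtocol X Y Z → CommProtocol Y X Z
  | .output z => .output z
  | .sendA b P Q => .sendB b P.swap Q.swap
  | .sendB b P Q => .sendA b P.swap Q.swap

theorem swap_run (P : CommProtocol X Y Z) (x : X) (y : Y) : P.swap.run y x = P.run x y := by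
  induction P with
  | output z => rfl
  | sendA b P Q hP hQ => simp [swap, run, hP, hQ]
  | sendB b P Q hP hQ => simp [swap, run, hP, hQ]

theorem swap_cost (P : CommProtocol X Y Z) : P.swap.cost = P.cost := by
  induction P with
  | output z => rfl
  | sendA b P Q hP hQ => simp [swap, cost, hP, hQ]
  | sendB b P Q hP hQ => simp [swap, cost, hP, hQ]

theorem Solvable.swap {D : X → Y → Prop} {R : X → Y → Z → Prop} {k : ℕ} (h : Solvable D R k) :
    Solvable (fun y x => D x y) (fun y x => R x y) k := by
  obtain ⟨P, hc, hP⟩ := h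
  exact ⟨P.swap, by rwa [swap_cost], fun y x hxy => by rw [swap_run]; exact hP x y hxy⟩

theorem Solvable.sendB {D : X → Y → Prop} {R : X → Y → Z → Prop} {k : ℕ} (b : Y → Prop)
    (h₁ : Solvable (fun x y => D x y ∧ b y) R k) (h₀ : Solvable (fun x y => D x y ∧ ¬ b y) R k) :
    Solvable D R (k + 1) :=
  (Solvable.sendA b h₁.swap h₀.swap).swap

/-- Player `A` announces a natural number with `m` bits. -/
theorem Solvable.announceNat {D : X → Y → Prop} {R : X → Y → Z → Prop} {k m : ℕ} {f : X → ℕ}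
    (hf : ∀ x, f x < 2 ^ m) (h : ∀ a, Solvable (fun x y => D x y ∧ f x = a) R k) :
    Solvable D R (m + k) := by
  induction m generalizing D f with
  | zero =>
    refine (h 0).mono (fun x y hxy => ⟨hxy, ?_⟩) (fun _ _ _ _ h => h) (by omega)
    simpa using hf x
  | succ m ih =>
    rw [show m + 1 + k = m + k + 1 by omega]
    refine Solvable.sendA (fun x => f x < 2 ^ m) ?_ ?_
    -- The truncation makes the bound hold for all `x`; it changes nothing where the bit just sent
    -- promises `f x < 2 ^ m`.
    · refine ih (f := fun x => min (f x) (2 ^ m - 1)) (fun x => ?_) fun a => ?_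
      · have := Nat.two_pow_pos m
        omega
      · refine (h a).mono (fun x y hxy => ⟨hxy.1.1, ?_⟩) (fun _ _ _ _ h => h) le_rfl
        have := hxy.1.2
        have := hxy.2
        omega
    · refine ih (f := fun x => f x - 2 ^ m) (fun x => ?_) fun a => ?_
      · have := hf x
        have := Nat.two_pow_pos m
        rw [pow_succ] at *
        omega
      · refine (h (a + 2 ^ m)).mono (fun x y hxy => ⟨hxy.1.1, ?_⟩) (fun _ _ _ _ h => h) le_rfl
        have := hxy.1.2
        have := hxy.2
        omega

theorem Solvable.announce {α : Type*} [Fintype α] [Nonempty α] {D : X → Y → Prop} {R : X → Y → Z → Prop}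
    {k m : ℕ} (f : X → α) (hm : Fintype.card α ≤ 2 ^ m)
    (h : ∀ a, Solvable (fun x y => D x y ∧ f x = a) R k) :
    Solvable D R (m + k) := by
  obtain ⟨a₀⟩ := ‹Nonempty α›
  let e := Fintype.equivFin α
  refine Solvable.announceNat (f := fun x => (e (f x)).1) (fun x => (e (f x)).2.trans_le hm) ?_
  intro n
  by_cases hn : n < Fintype.card α
  · refine (h (e.symm ⟨n, hn⟩)).mono (fun x y hxy => ⟨hxy.1, ?_⟩) (fun _ _ _ _ h => h) le_rfl
    rw [Equiv.eq_symm_apply]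
    exact Fin.ext hxy.2
  · refine (h a₀).mono (fun x y hxy => ?_) (fun _ _ _ _ h => h) le_rfl
    exact (hn (hxy.2 ▸ (e (f x)).2)).elim

/-- Player `A` knows a sequence `q`; from an element with property `p` at the beginning to one
with property `r` at the end the players find two consecutive such elements by binary search,
where `B` knows which elements have the properties. -/
theorem Solvable.binarySearch {α : Type} [Fintype α] [Nonempty α] {D : X → Y → Prop} {R : X → Y → Z → Prop}
    {k : ℕ} (hk : Fintype.card α ≤ 2 ^ k) (q : X → ℕ → α) (p r : Y → α → Prop) (out : X → ℕ → Z)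
    (hout : ∀ x y l, D x y → p y (q x l) → r y (q x (l + 1)) → R x y (out x l))
    (bad : α → Z) (hbad : ∀ x y l, D x y → ¬ p y (q x l) → ¬ r y (q x l) → R x y (bad (q x l)))
    {K : ℕ} (hK : ∀ l, Solvable (fun x y => D x y ∧ R x y (out x l)) R K) (L : ℕ)
    (l : ℕ) :
    Solvable (fun x y => D x y ∧ p y (q x l) ∧ r y (q x (l + 2 ^ L))) R (L * (k + 2) + K) := by
  induction L generalizing l with
  | zero =>
    exact (hK l).mono (fun x y h => ⟨h.1, hout x y l h.1 h.2.1 h.2.2⟩) (fun _ _ _ _ h => h)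
      (by omega)
  | succ L ih =>
    rw [show (L + 1) * (k + 2) + K = k + (L * (k + 2) + K + 1 + 1) by ring]
    -- The midpoint costs `k` bits to announce and at most two to answer. It becomes the new left
    -- end if `p` holds and the new right end if `r` holds; otherwise it is itself the answer.
    refine Solvable.announce (fun x => q x (l + 2 ^ L)) hk fun a => ?_
    refine Solvable.sendB (fun y => p y a) ?_ (Solvable.sendB (fun y => r y a) ?_ ?_)
    · refine (ih (l + 2 ^ L)).mono ?_ (fun _ _ _ _ h => h) (by omega)
      rintro x y ⟨⟨⟨hD, hp, hr⟩, ha⟩, hpa⟩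
      refine ⟨hD, ha ▸ hpa, ?_⟩
      rwa [show l + 2 ^ L + 2 ^ L = l + 2 ^ (L + 1) by rw [pow_succ]; ring]
    · refine (ih l).mono ?_ (fun _ _ _ _ h => h) (by omega)
      rintro x y ⟨⟨⟨⟨hD, hp, hr⟩, ha⟩, hpa⟩, hra⟩
      exact ⟨hD, hp, ha ▸ hra⟩
    · refine (Solvable.output (bad a) ?_).mono (fun _ _ h => h) (fun _ _ _ _ h => h) (by omega)
      rintro x y ⟨⟨⟨⟨hD, hp, hr⟩, ha⟩, hpa⟩, hra⟩
      have := hbad x y (l + 2 ^ L) hD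
      rw [ha] at this
      exact this hpa hra

end CommProtocol

/-! ### From geometric triangulations to vertex labels, valid outputs and vertex sequences. -/

namespace SimplexTriangulation

variable {d n : ℕ} (T : SimplexTriangulation d n)

theorem point_injective : Function.Injective T.point :=
  Subtype.val_injective.comp T.label.injective

theorem exists_point_eq {x : Fin (d + 1) → ℝ} (hx : x ∈ T.complex.vertices) :
    ∃ k, T.point k = x :=
  ⟨T.label.symm ⟨x, hx⟩, by simp [point]⟩

theorem exists_image_point_eq {s : Finset (Fin (d + 1) → ℝ)} (hs : s ∈ T.complex.faces) :
    ∃ r : Finset (Fin n), r.image T.point = s := by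
  classical
  refine ⟨Finset.univ.filter fun k => T.point k ∈ s, ?_⟩
  ext x
  simp only [Finset.mem_image, Finset.mem_filter, Finset.mem_univ, true_and]
  constructor
  · rintro ⟨k, hk, rfl⟩
    exact hk
  · intro hx
    obtain ⟨k, rfl⟩ := T.exists_point_eq (T.complex.down_closed hs
      (Finset.singleton_subset_iff.2 hx) (Finset.singleton_nonempty x))
    exact ⟨k, hx, rfl⟩

theorem finite_faces : T.complex.faces.Finite := by
  refine (Set.finite_range fun r : Finset (Fin n) => r.image T.point).subset fun s hs => ?_
  obtain ⟨r, hr⟩ := T.exists_image_point_eq hs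
  exact ⟨r, by convert hr⟩

open Classical in
/-- The simplices, as sets of labels. -/
noncomputable def simplices : Finset (Finset (Fin n)) :=
  {s | s.image T.point ∈ T.complex.faces}

/-- The corners of the smallest face containing a vertex. -/
noncomputable def support (k : Fin n) : Finset (Fin (d + 1)) :=
  {i | T.point k i ≠ 0}

theorem mem_simplices {s : Finset (Fin n)} :
    s ∈ T.simplices ↔ s.image T.point ∈ T.complex.faces := by
  simp only [simplices, Finset.mem_filter, Finset.mem_univ, true_and]

theorem mem_support {k : Fin n} {i : Fin (d + 1)} : i ∈ T.support k ↔ T.point k i ≠ 0 := by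
  simp [support]

theorem point_mem_stdSimplex (k : Fin n) : T.point k ∈ stdSimplex ℝ (Fin (d + 1)) :=
  T.space_eq ▸ T.complex.vertices_subset_space (T.label k).2

theorem mem_simplexCarrier_point {k : Fin n} {i : Fin (d + 1)} :
    i ∈ simplexCarrier (T.point k) ↔ i ∈ T.support k := by
  rw [mem_simplexCarrier_iff (T.point_mem_stdSimplex k), mem_support]

theorem support_subset_iff {k : Fin n} {I : Finset (Fin (d + 1))} :
    T.support k ⊆ I ↔ ∀ i ∉ I, T.point k i = 0 := by
  constructor
  · intro h i hi
    by_contra h0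
    exact hi (h (T.mem_support.2 h0))
  · intro h i hi
    by_contra hiI
    exact T.mem_support.1 hi (h i hiI)

theorem mem_extensions_iff {I : Finset (Fin (d + 1))} {s : Finset (Fin n)} {w : Fin n} :
    w ∈ extensions T.simplices T.support I s ↔
      T.point w ∉ s.image T.point ∧ insert (T.point w) (s.image T.point) ∈ T.complex.faces ∧
        ∀ i ∉ I, T.point w i = 0 := by
  rw [mem_extensions, mem_simplices, support_subset_iff, Finset.image_insert,
    T.point_injective.mem_finset_image]

theorem exists_point_eq_of_insert_mem {s : Finset (Fin (d + 1) → ℝ)} {w : Fin (d + 1) → ℝ}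
    (h : insert w s ∈ T.complex.faces) : ∃ k, T.point k = w :=
  T.exists_point_eq (T.complex.down_closed h
    (Finset.singleton_subset_iff.2 (Finset.mem_insert_self _ _)) (Finset.singleton_nonempty _))

theorem isTriangulatedSimplex : IsTriangulatedSimplex T.simplices T.support where
  nonempty s hs := by
    simpa using Geometry.SimplicialComplex.nonempty_of_mem_faces (T.mem_simplices.1 hs)
  down s hs t hts ht := T.mem_simplices.2 (T.complex.down_closed (T.mem_simplices.1 hs)
    (Finset.image_subset_image hts) (ht.image _))
  corner i := by
    obtain ⟨v, hv⟩ := T.exists_point_eq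
      (Geometry.SimplicialComplex.single_mem_vertices T.space_eq i)
    refine ⟨v, ?_, fun w => ⟨fun h => ?_, ?_⟩⟩
    · rw [mem_simplices, Finset.image_singleton]
      exact (T.label v).2
    · rw [support_subset_iff] at h
      apply T.point_injective
      rw [hv]
      have h1 := (T.point_mem_stdSimplex w).2
      rw [Finset.sum_eq_single i (fun k _ hk => h k (by simpa using hk)) (by simp)] at h1
      funext k
      rcases eq_or_ne k i with rfl | hk
      · simpa using h1
      · rw [h k (by simpa using hk), Pi.single_eq_of_ne hk]
    · rintro rfl
      rw [support_subset_iff, hv]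
      intro k hk
      exact Pi.single_eq_of_ne (by simpa using hk) _
  card_extensions_boundary I s hs hI hc := by
    rintro ⟨j, hjI, hj⟩
    obtain ⟨w, hw, hu⟩ := Geometry.SimplicialComplex.existsUnique_coface T.space_eq T.finite_faces
      (T.mem_simplices.1 hs) (I := I)
      (Finset.forall_mem_image.2 fun v hv => T.support_subset_iff.1 (hI v hv))
      (by rwa [Finset.card_image_of_injective _ T.point_injective]) hjI
      (Finset.forall_mem_image.2 fun v hv => by simpa [mem_support] using hj v hv)
    obtain ⟨k, rfl⟩ := T.exists_point_eq_of_insert_mem hw.2.1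
    rw [Finset.card_eq_one]
    refine ⟨k, ?_⟩
    ext l
    rw [mem_extensions_iff, Finset.mem_singleton]
    refine ⟨fun h => T.point_injective (hu _ h), ?_⟩
    rintro rfl
    exact hw
  card_extensions_interior I s hs hI hc hint := by
    obtain ⟨w₁, w₂, hne, hw⟩ := Geometry.SimplicialComplex.exists_two_cofaces T.space_eq
      T.finite_faces (T.mem_simplices.1 hs) (I := I)
      (Finset.forall_mem_image.2 fun v hv => T.support_subset_iff.1 (hI v hv))
      (by rwa [Finset.card_image_of_injective _ T.point_injective]) (by
        intro j hj
        by_contra! hcon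
        refine hint ⟨j, hj, fun v hv hjv => T.mem_support.1 hjv ?_⟩
        exact hcon _ (Finset.mem_image_of_mem _ hv))
    obtain ⟨k₁, rfl⟩ := T.exists_point_eq_of_insert_mem ((hw w₁).2 (Or.inl rfl)).2.1
    obtain ⟨k₂, rfl⟩ := T.exists_point_eq_of_insert_mem ((hw w₂).2 (Or.inr rfl)).2.1
    rw [Finset.card_eq_two]
    refine ⟨k₁, k₂, fun h => hne (by rw [h]), ?_⟩
    ext l
    rw [mem_extensions_iff, hw, T.point_injective.eq_iff, T.point_injective.eq_iff]
    simp

theorem succ_le_card_vertices (T : SimplexTriangulation d n) : d + 1 ≤ n := by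
  choose v hv using fun i : Fin (d + 1) => T.exists_point_eq
    (Geometry.SimplicialComplex.single_mem_vertices T.space_eq i)
  have hinj : Function.Injective v := by
    intro i j hij
    have h : (Pi.single i 1 : Fin (d + 1) → ℝ) = Pi.single j 1 := by rw [← hv, ← hv, hij]
    by_contra hne
    have := congrFun h i
    rw [Pi.single_eq_same, Pi.single_eq_of_ne hne] at this
    exact one_ne_zero this
  simpa using Fintype.card_le_of_injective v hinj

/-- The valid outputs for given classes. -/
def IsValid (C : Fin (d + 1) → Finset (Fin n)) : SpernerOutput d n → Prop
  | .simplex x => T.IsPanchromatic C x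
  | .violation x => T.IsViolation C x

variable {T}

theorem isPanchromatic_of_mem {C : Fin (d + 1) → Finset (Fin n)} {s : Finset (Fin n)}
    (hs : s ∈ T.simplices) (hc : s.card = d + 1) {x : Fin (d + 1) → Fin n} (hx : ∀ i, x i ∈ s)
    (hinj : Function.Injective x) (hC : ∀ i, x i ∈ C i) : T.IsPanchromatic C x := by
  refine ⟨hC, hinj, _, T.mem_simplices.1 hs, ?_⟩
  have : s = Finset.univ.image x := by
    refine (Finset.eq_of_subset_of_card_le (Finset.image_subset_iff.2 fun i _ => hx i) ?_).symm
    rw [Finset.card_image_of_injective _ hinj, hc]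
    simp
  rw [this, Finset.image_image]
  simp [Function.comp_def]

/-- The search problem is total: without a violation, choosing a class for every vertex gives a
Sperner-coloring, and an odd number of panchromatic simplices is not zero. -/
theorem exists_isValid (T : SimplexTriangulation d n) (C : Fin (d + 1) → Finset (Fin n)) :
    ∃ z, T.IsValid C z := by
  classical
  by_cases hv : ∃ v, T.IsViolation C v
  · exact ⟨.violation hv.choose, hv.choose_spec⟩
  push Not at hv
  have h1 : ∀ v, ∃ i, v ∈ C i := fun v => by
    by_contra! h
    exact hv v (Or.inl h)
  choose c hc using h1
  have hsp : ∀ v, c v ∈ T.support v := fun v => by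
    by_contra h
    exact hv v (Or.inr (Or.inr ⟨c v, hc v, fun h' => h (T.mem_simplexCarrier_point.1 h')⟩))
  have hodd := T.isTriangulatedSimplex.odd_card_panchromatic c Finset.univ Finset.univ_nonempty
    fun v _ => hsp v
  have hne : ({s ∈ fullSimplices T.simplices T.support Finset.univ |
      s.image c = Finset.univ}).Nonempty := by
    rw [← Finset.card_pos]
    by_contra h0
    rw [Nat.eq_zero_of_not_pos h0] at hodd
    simp at hodd
  obtain ⟨s, hs⟩ := hne
  obtain ⟨hs, himg⟩ := Finset.mem_filter.1 hs
  obtain ⟨hsF, -, hcard⟩ := mem_fullSimplices.1 hs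
  have hex : ∀ i, ∃ v ∈ s, c v = i := fun i =>
    Finset.mem_image.1 (himg ▸ Finset.mem_univ i)
  choose x hx hxc using hex
  exact ⟨.simplex x, isPanchromatic_of_mem hsF (by simpa using hcard) hx
    (Function.LeftInverse.injective hxc) fun i => by have := hc (x i); rwa [hxc] at this⟩

/-- Here `p` marks the colors whose absence at `v` need not be known: either `v` has one of them,
which is illegal, or it has no color. -/
theorem IsViolation.of_forall_notMem_ne {C : Fin (d + 1) → Finset (Fin n)} {v : Fin n}
    {p : Fin (d + 1) → Prop} (h : ∀ k, ¬ p k → v ∉ C k) (hp : ∀ k, p k → k ∉ T.support v) :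
    T.IsViolation C v := by
  by_cases hk : ∃ k, v ∈ C k
  · obtain ⟨k, hk⟩ := hk
    have hpk : p k := by
      by_contra hpk
      exact h k hpk hk
    exact Or.inr (Or.inr ⟨k, hk, fun h' => hp k hpk (T.mem_simplexCarrier_point.1 h')⟩)
  · push Not at hk
    exact Or.inl hk

/-- If one class is replaced by the complement of the others, then the outputs keep their validity,
except that a panchromatic simplex may turn into a violation at one of its vertices. -/
theorem IsValid.of_update {C : Fin (d + 1) → Finset (Fin n)} {i : Fin (d + 1)}
    {z : SpernerOutput d n}
    (hz : T.IsValid (Function.update C i (Finset.univ.filter fun v => ∀ k, k ≠ i → v ∉ C k)) z) :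
    (∃ x, z = .simplex x ∧ x i ∉ C i ∧ T.IsValid C (.violation (x i))) ∨
      ((∀ x, z = .simplex x → x i ∈ C i) ∧ T.IsValid C z) := by
  set C' := Function.update C i (Finset.univ.filter fun v => ∀ k, k ≠ i → v ∉ C k) with hC'
  have hne : ∀ k, k ≠ i → C' k = C k := fun k hk => Function.update_of_ne hk _ _
  have hi : ∀ v, v ∈ C' i ↔ ∀ k, k ≠ i → v ∉ C k := by simp [hC']
  cases z with
  | simplex x =>
    obtain ⟨h1, h2, h3⟩ := hz
    by_cases hx : x i ∈ C i
    · refine Or.inr ⟨fun y hy => ?_, fun k => ?_, h2, h3⟩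
      · cases hy
        exact hx
      · rcases eq_or_ne k i with rfl | hk
        · exact hx
        · exact hne k hk ▸ h1 k
    · refine Or.inl ⟨x, rfl, hx, Or.inl fun k => ?_⟩
      rcases eq_or_ne k i with rfl | hk
      · exact hx
      · exact (hi _).1 (h1 i) k hk
  | violation v =>
    refine Or.inr ⟨fun x hx => (nomatch hx), ?_⟩
    rcases hz with h | ⟨k, l, hkl, hk, hl⟩ | ⟨k, hk, hkv⟩
    · exact absurd ((hi v).2 fun k hk => hne k hk ▸ h k) (h i)
    · by_cases hki : k = i
      · subst hki
        exact absurd (hne l hkl.symm ▸ hl) ((hi v).1 hk l hkl.symm)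
      by_cases hli : l = i
      · subst hli
        exact absurd (hne k hkl ▸ hk) ((hi v).1 hl k hkl)
      exact Or.inr (Or.inl ⟨k, l, hkl, hne k hki ▸ hk, hne l hli ▸ hl⟩)
    · by_cases hki : k = i
      · subst hki
        exact IsViolation.of_forall_notMem_ne (p := fun l => l = k) ((hi v).1 hk) (by
          rintro _ rfl h
          exact hkv (T.mem_simplexCarrier_point.2 h))
      · exact Or.inr (Or.inr ⟨k, hne k hki ▸ hk, hkv⟩)

/-- A vertex at which the classes other than `i` and `j` are already seen not to be color classes
of a Sperner-coloring. -/
def IsPartialViolation (T : SimplexTriangulation d n) (i j : Fin (d + 1))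
    (a : Fin (d + 1) → Finset (Fin n)) (v : Fin n) : Prop :=
  (∃ k, k ≠ i ∧ k ≠ j ∧ v ∈ a k ∧ k ∉ T.support v) ∨
    ((∀ k, k ≠ i → k ≠ j → v ∉ a k) ∧ i ∉ T.support v ∧ j ∉ T.support v)

theorem IsPartialViolation.isViolation {i j : Fin (d + 1)} {a C : Fin (d + 1) → Finset (Fin n)}
    {v : Fin n} (h : T.IsPartialViolation i j a v) (hC : ∀ k, k ≠ i → k ≠ j → C k = a k) :
    T.IsViolation C v := by
  rcases h with ⟨k, hki, hkj, hk, hkv⟩ | ⟨h, hi, hj⟩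
  · exact Or.inr (Or.inr ⟨k, hC k hki hkj ▸ hk, fun h' => hkv (T.mem_simplexCarrier_point.1 h')⟩)
  · refine IsViolation.of_forall_notMem_ne (p := fun k => k = i ∨ k = j) (fun k hk => ?_) ?_
    · push Not at hk
      exact hC k hk.1 hk.2 ▸ h k hk.1 hk.2
    · rintro k (rfl | rfl)
      · exact hi
      · exact hj

/-- All colors but `i` and `j` determine a sequence of vertices without these colors that leads
from the facet opposite to `j` to the facet opposite to `i`, such that two consecutive vertices are
in a simplex with all these colors. -/
theorem exists_vertex_sequence {i j : Fin (d + 1)} (hij : i ≠ j)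
    {a : Fin (d + 1) → Finset (Fin n)} (ha : ∀ v, ¬ T.IsPartialViolation i j a v) :
    ∃ (q : ℕ → Fin n) (out : ℕ → SpernerOutput d n),
      (∀ l k, k ≠ i → k ≠ j → q l ∉ a k) ∧ j ∉ T.support (q 0) ∧
      (∀ l, n ^ d ≤ l → i ∉ T.support (q l)) ∧
      ∀ l C, (∀ k, k ≠ i → k ≠ j → C k = a k) → q l ∈ C i → q (l + 1) ∈ C j →
        T.IsValid C (out l) := by
  classical
  -- Color `i` serves as the default for vertices in none of the known classes; they may turn out to
  -- belong to `C i` or to `C j`.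
  have hcol : ∀ v, ∃ k, k ≠ j ∧ (k ≠ i → v ∈ a k) ∧
      (k = i → ∀ k, k ≠ i → k ≠ j → v ∉ a k) := by
    intro v
    by_cases h : ∃ k, k ≠ i ∧ k ≠ j ∧ v ∈ a k
    · obtain ⟨k, hki, hkj, hk⟩ := h
      exact ⟨k, hkj, fun _ => hk, fun h => absurd h hki⟩
    · push Not at h
      exact ⟨i, hij, fun h => absurd rfl h, fun _ => h⟩
  choose c hcj hca hci using hcol
  obtain ⟨q, hq0, hqN, hq⟩ := T.isTriangulatedSimplex.exists_door_walk hij c hcj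
    (fun v hv => by
      by_contra h
      exact ha v (Or.inl ⟨c v, hv, hcj v, hca v hv, h⟩))
    (fun v hv => by
      by_contra! h
      exact ha v (Or.inr ⟨hci v hv, h⟩))
  have hstar : ∀ s : Door T.simplices c j, ∀ k, k ≠ j → ∃ v ∈ s.1, c v = k := by
    intro s k hk
    have : k ∈ s.1.image c := by rw [s.2.2.2]; simp [hk]
    exact Finset.mem_image.1 this
  choose star hstar hstarc using hstar
  have hvalid : ∀ l, ∃ z : SpernerOutput d n, ∀ C, (∀ k, k ≠ i → k ≠ j → C k = a k) →
      star (q l) i hij ∈ C i → star (q (l + 1)) i hij ∈ C j → T.IsValid C z := by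
    intro l
    set u := star (q l) i hij with hu
    set u' := star (q (l + 1)) i hij with hu'
    -- If the `i`-colored vertex does not change, membership in both `C i` and `C j` is a violation.
    by_cases huu : u = u'
    · refine ⟨.violation u, fun C _ h1 h2 => Or.inr (Or.inl ⟨i, j, hij, h1, ?_⟩)⟩
      rwa [huu]
    obtain ⟨r, hr, hrc, hl, hl'⟩ := (hq l).resolve_left fun h => huu (by rw [hu, hu', h])
    have hinj : Set.InjOn c (q l).1 := by
      rw [← Finset.card_image_iff, (q l).2.2.2, Finset.card_erase_of_mem (Finset.mem_univ _),
        Finset.card_univ]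
      have := (q l).2.2.1
      omega
    -- The first door contains only one vertex colored `i`, so `u'` is its missing vertex in `r`; it
    -- takes the role of color `j`.
    have hu's : u' ∉ (q l).1 := fun h => huu
      (hinj (hstar (q l) i hij) h ((hstarc _ _ _).trans (hstarc _ _ _).symm))
    refine ⟨.simplex fun k => if h : k = j then u' else star (q l) k h, fun C hC h1 h2 => ?_⟩
    refine isPanchromatic_of_mem hr (by simpa using hrc) (fun k => ?_) ?_ fun k => ?_
    · split_ifs with h
      · exact hl' (hstar _ _ _)
      · exact hl (hstar _ _ _)
    · intro k l' hkl
      dsimp only at hkl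
      split_ifs at hkl with h1 h2 h2
      · rw [h1, h2]
      · exact absurd (hkl ▸ hstar _ _ _) hu's
      · exact absurd (hkl ▸ hstar _ _ _) hu's
      · rw [← hstarc (q l) k h1, hkl, hstarc]
    · split_ifs with h
      · rwa [h]
      · by_cases hki : k = i
        · subst hki
          exact h1
        · rw [hC k hki h]
          have := hca (star (q l) k h)
          rw [hstarc] at this
          exact this hki
  choose out hout using hvalid
  refine ⟨fun l => star (q l) i hij, out, fun l => hci _ (hstarc _ _ _), hq0 _ (hstar _ _ _),
    fun l hl => hqN l (by simpa using hl) _ (hstar _ _ _), hout⟩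

end SimplexTriangulation

/-- The outputs are tuples or single vertices. -/
def spernerOutputEquiv (d n : ℕ) : SpernerOutput d n ≃ (Fin (d + 1) → Fin n) ⊕ Fin n where
  toFun
    | .simplex x => .inl x
    | .violation x => .inr x
  invFun := Sum.elim .simplex .violation
  left_inv z := by cases z <;> rfl
  right_inv z := by cases z <;> rfl

noncomputable instance (d n : ℕ) : Fintype (SpernerOutput d n) :=
  Fintype.ofEquiv _ (spernerOutputEquiv d n).symm

theorem card_spernerOutput_le {d n k : ℕ} (hk : n ≤ 2 ^ k) :
    Fintype.card (SpernerOutput d n) ≤ 2 ^ (k * (d + 1) + 1) := by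
  rw [Fintype.card_congr (spernerOutputEquiv d n)]
  simp only [Fintype.card_sum, Fintype.card_fun, Fintype.card_fin]
  have h1 : n ^ (d + 1) ≤ 2 ^ (k * (d + 1)) := by
    rw [pow_mul]
    exact Nat.pow_le_pow_left hk _
  have h2 : n ≤ 2 ^ (k * (d + 1)) :=
    hk.trans (Nat.pow_le_pow_right two_pos (Nat.le_mul_of_pos_right _ (Nat.succ_pos _)))
  rw [pow_succ _ (k * (d + 1))]
  omega

/-! ### The protocols and their cost. -/

namespace SimplexTriangulation

open CommProtocol

variable {d n : ℕ} {X Y : Type} {T : SimplexTriangulation d n}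
  {C : X → Y → Fin (d + 1) → Finset (Fin n)} {k : ℕ}

/-- One player knows all classes. -/
theorem solvable_of_all (hn : 0 < n) (hk : n ≤ 2 ^ k) (a : X → Fin (d + 1) → Finset (Fin n))
    (ha : ∀ x y, C x y = a x) :
    Solvable (fun _ _ => True) (fun x y => T.IsValid (C x y)) (k * (d + 1) + 1 + 0) := by
  have : Nonempty (SpernerOutput d n) := ⟨.violation ⟨0, hn⟩⟩
  choose z hz using fun x => T.exists_isValid (a x)
  refine Solvable.announce z (card_spernerOutput_le hk) fun w => Solvable.output w ?_
  rintro x y ⟨-, rfl⟩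
  exact ha x y ▸ hz x

/-- One player knows all classes but one. -/
theorem solvable_of_all_but_one (hn : 0 < n) (hk : n ≤ 2 ^ k) (i : Fin (d + 1))
    (a : X → Fin (d + 1) → Finset (Fin n)) (b : Y → Finset (Fin n))
    (ha : ∀ x y l, l ≠ i → C x y l = a x l) (hb : ∀ x y, C x y i = b y) :
    Solvable (fun _ _ => True) (fun x y => T.IsValid (C x y)) (k * (d + 1) + 1 + 1) := by
  have : Nonempty (SpernerOutput d n) := ⟨.violation ⟨0, hn⟩⟩
  -- The missing class is guessed to be the complement of the known ones. In a simplex found this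
  -- way only the entry `x i` is in doubt; if it is not in the true class, it has no color at all.
  choose z hz using fun x =>
    T.exists_isValid (Function.update (a x) i (Finset.univ.filter fun v => ∀ l, l ≠ i → v ∉ a x l))
  have hz' : ∀ x y, T.IsValid (Function.update (C x y) i
      (Finset.univ.filter fun v => ∀ l, l ≠ i → v ∉ C x y l)) (z x) := by
    intro x y
    convert hz x using 1
    funext l
    rcases eq_or_ne l i with rfl | hl
    · simp only [Function.update_self]
      exact Finset.filter_congr fun v _ => forall₂_congr fun m hm => by rw [ha x y m hm]
    · rw [Function.update_of_ne hl, Function.update_of_ne hl, ha x y l hl]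
  refine Solvable.announce z (card_spernerOutput_le hk) fun w => ?_
  cases w with
  | violation v =>
    refine (Solvable.output (.violation v) ?_).mono (fun _ _ h => h) (fun _ _ _ _ h => h)
      (Nat.zero_le _)
    rintro x y ⟨-, hx⟩
    rcases (hz' x y).of_update with ⟨x', h1, -⟩ | ⟨-, h⟩
    · rw [hx] at h1
      cases h1
    · rwa [hx] at h
  | simplex v =>
    refine Solvable.sendB (fun y => v i ∈ b y) (Solvable.output (.simplex v) ?_)
      (Solvable.output (.violation (v i)) ?_)
    · rintro x y ⟨⟨-, hx⟩, hv⟩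
      rcases (hz' x y).of_update with ⟨x', h1, h2, -⟩ | ⟨-, h⟩
      · rw [hx] at h1
        cases h1
        exact absurd (hb x y ▸ hv) h2
      · rwa [hx] at h
    · rintro x y ⟨⟨-, hx⟩, hv⟩
      rcases (hz' x y).of_update with ⟨x', h1, -, h2⟩ | ⟨h, -⟩
      · rw [hx] at h1
        cases h1
        exact h2
      · exact absurd (hb x y ▸ h v hx) hv

/-- One player knows all classes but two. -/
theorem solvable_of_all_but_two (hn : 0 < n) (hk : n ≤ 2 ^ k) {i j : Fin (d + 1)} (hij : i ≠ j)
    (a : X → Fin (d + 1) → Finset (Fin n)) (b b' : Y → Finset (Fin n))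
    (ha : ∀ x y l, l ≠ i → l ≠ j → C x y l = a x l) (hb : ∀ x y, C x y i = b y)
    (hb' : ∀ x y, C x y j = b' y) :
    Solvable (fun _ _ => True) (fun x y => T.IsValid (C x y))
      (k + (k + (k * d * (k + 2) + (k * (d + 1) + 1 + 0) + 1) + 1) + 1) := by
  classical
  have : Nonempty (Fin n) := ⟨⟨0, hn⟩⟩
  have : Nonempty (SpernerOutput d n) := ⟨.violation ⟨0, hn⟩⟩
  have hkn : Fintype.card (Fin n) ≤ 2 ^ k := by simpa using hk
  refine Solvable.sendA (fun x => ∃ v, T.IsPartialViolation i j (a x) v) ?_ ?_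
  · have hv : ∀ x, ∃ v, (∃ v, T.IsPartialViolation i j (a x) v) →
        T.IsPartialViolation i j (a x) v := fun x => by
      by_cases h : ∃ v, T.IsPartialViolation i j (a x) v
      · exact ⟨h.choose, fun _ => h.choose_spec⟩
      · exact ⟨⟨0, hn⟩, fun h' => absurd h' h⟩
    choose v hv using hv
    refine (Solvable.announce v hkn fun w => Solvable.output (.violation w) ?_).mono
      (fun _ _ h => h) (fun _ _ _ _ h => h) (by omega)
    rintro x y ⟨⟨-, h⟩, rfl⟩
    exact (hv x h).isViolation (ha x y)
  have hseq := fun x (hx : ∀ v, ¬ T.IsPartialViolation i j (a x) v) =>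
    exists_vertex_sequence hij hx
  choose! q out hqa hq0 hqN hout using hseq
  have hD : ∀ x : X, (True ∧ ¬ ∃ v, T.IsPartialViolation i j (a x) v) →
      ∀ v, ¬ T.IsPartialViolation i j (a x) v := fun x h => not_exists.1 h.2
  -- The common reason for all violations on the sequence, used with `p` being only `j` at the
  -- start, only `i` at the end, and empty in between.
  have hbad : ∀ x y l, (True ∧ ¬ ∃ v, T.IsPartialViolation i j (a x) v) → ∀ p : Fin (d + 1) → Prop,
      (¬ p i → q x l ∉ b y) → (¬ p j → q x l ∉ b' y) → (∀ m, p m → m ∉ T.support (q x l)) →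
      T.IsValid (C x y) (.violation (q x l)) := by
    intro x y l h p hi hj hp
    refine IsViolation.of_forall_notMem_ne (p := p) (fun m hm => ?_) hp
    by_cases hmi : m = i
    · subst hmi
      exact hb x y ▸ hi hm
    by_cases hmj : m = j
    · subst hmj
      exact hb' x y ▸ hj hm
    rw [ha x y m hmi hmj]
    exact hqa x (hD x h) l m hmi hmj
  refine Solvable.announce (fun x => q x 0) hkn fun v₀ =>
    Solvable.sendB (fun y => v₀ ∈ b y) ?_ ?_
  swap
  · refine (Solvable.output (.violation v₀) ?_).mono (fun _ _ h => h) (fun _ _ _ _ h => h)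
      (Nat.zero_le _)
    rintro x y ⟨⟨h, rfl⟩, hv⟩
    refine hbad x y 0 h (fun m => m = j) (fun _ => hv) (fun h => absurd rfl h) ?_
    rintro _ rfl
    exact hq0 x (hD x h)
  -- Since `n ^ d ≤ 2 ^ (k * d)`, the sequence has reached the facet opposite to `i` here, and the
  -- interval has the power-of-two length that binary search needs.
  refine Solvable.announce (fun x => q x (0 + 2 ^ (k * d))) hkn fun v₁ =>
    Solvable.sendB (fun y => v₁ ∈ b' y) ?_ ?_
  swap
  · refine (Solvable.output (.violation v₁) ?_).mono (fun _ _ h => h) (fun _ _ _ _ h => h)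
      (Nat.zero_le _)
    rintro x y ⟨⟨⟨⟨h, -⟩, -⟩, rfl⟩, hv⟩
    refine hbad x y _ h (fun m => m = i) (fun h => absurd rfl h) (fun _ => hv) ?_
    rintro _ rfl
    refine hqN x (hD x h) _ ?_
    rw [zero_add, pow_mul]
    exact Nat.pow_le_pow_left hk d
  refine (Solvable.binarySearch (D := fun x _ => True ∧ ¬ ∃ v, T.IsPartialViolation i j (a x) v)
    hkn q (fun y v => v ∈ b y) (fun y v => v ∈ b' y) out ?_ .violation ?_
    (K := k * (d + 1) + 1 + 0) ?_ (k * d) 0).mono ?_ (fun _ _ _ _ h => h) le_rfl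
  · intro x y l h h1 h2
    exact hout x (hD x h) l (C x y) (ha x y) (hb x y ▸ h1) (hb' x y ▸ h2)
  · intro x y l h h1 h2
    exact hbad x y l h (fun _ => False) (fun _ => h1) (fun _ => h2) (fun _ h => h.elim)
  · intro l
    refine Solvable.announce (fun x => out x l) (card_spernerOutput_le hk) fun w =>
      Solvable.output w ?_
    rintro x y ⟨⟨-, h⟩, rfl⟩
    exact h
  · rintro x y ⟨⟨⟨⟨h, rfl⟩, h1⟩, rfl⟩, h2⟩
    exact ⟨h, h1, h2⟩

theorem concatSperner_iff {t : ℕ} (a : SpernerInputA d n t) (b : SpernerInputB d n t)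
    (z : SpernerOutput d n) :
    T.concatSperner t a b z ↔ T.IsValid (spernerClasses a b) z := by
  cases z <;> rfl

theorem exists_protocol {t K : ℕ} (hd : 1 ≤ d)
    (hK : K ≤ (4 * d + 7) * Nat.clog 2 n ^ 2)
    (h : Solvable (fun _ _ => True)
      (fun (a : SpernerInputA d n t) b => T.IsValid (spernerClasses a b)) K) :
    ∃ P : CommProtocol (SpernerInputA d n t) (SpernerInputB d n t) (SpernerOutput d n),
      P.Solves (T.concatSperner t) ∧
        (P.cost : ℝ) ≤ (4 * (4 * d + 7) : ℝ) * Real.logb 2 (n : ℝ) ^ 2 := by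
  obtain ⟨P, hc, hP⟩ := h
  refine ⟨P, fun a b => (concatSperner_iff a b _).2 (hP a b trivial), ?_⟩
  have hn : 2 ≤ n := by have := T.succ_le_card_vertices; omega
  have hlog : 1 ≤ Real.logb 2 (n : ℝ) := by
    rw [Real.le_logb_iff_rpow_le one_lt_two (by positivity)]
    simpa using (by exact_mod_cast hn : (2 : ℝ) ≤ n)
  -- Rounding up adds at most 1, which is at most `logb 2 n` because `n ≥ 2`. Squaring the factor 2
  -- yields the 4 in the final constant.
  have hclog : (Nat.clog 2 n : ℝ) ≤ 2 * Real.logb 2 (n : ℝ) := by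
    have h1 : 0 < Nat.clog 2 n := Nat.clog_pos one_lt_two hn
    have h2 : 2 ^ (Nat.clog 2 n - 1) ≤ n := (Nat.pow_pred_clog_lt_self one_lt_two hn).le
    have h3 : ((Nat.clog 2 n - 1 : ℕ) : ℝ) ≤ Real.logb 2 (n : ℝ) := by
      rw [Real.le_logb_iff_rpow_le one_lt_two (by positivity), Real.rpow_natCast]
      exact_mod_cast h2
    rw [Nat.cast_sub h1] at h3
    push_cast at h3
    linarith
  calc (P.cost : ℝ) ≤ ((4 * d + 7) * Nat.clog 2 n ^ 2 : ℕ) := by exact_mod_cast hc.trans hK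
    _ = (4 * d + 7) * (Nat.clog 2 n : ℝ) ^ 2 := by push_cast; ring
    _ ≤ (4 * d + 7) * (2 * Real.logb 2 (n : ℝ)) ^ 2 := by gcongr
    _ = _ := by ring

/-- The classes of player `A`, with empty sets for the missing colors. -/
def classesA {t : ℕ} (a : SpernerInputA d n t) (i : Fin (d + 1)) : Finset (Fin n) :=
  if h : (i : ℕ) < t then a ⟨i, h⟩ else ∅

/-- The classes of player `B`, with empty sets for the missing colors. -/
def classesB {t : ℕ} (b : SpernerInputB d n t) (i : Fin (d + 1)) : Finset (Fin n) :=
  if h : t ≤ (i : ℕ) then b ⟨i, h⟩ else ∅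

theorem spernerClasses_of_lt {t : ℕ} (a : SpernerInputA d n t) (b : SpernerInputB d n t)
    {i : Fin (d + 1)} (h : (i : ℕ) < t) : spernerClasses a b i = classesA a i := by
  simp [spernerClasses, classesA, h]

theorem spernerClasses_of_le {t : ℕ} (a : SpernerInputA d n t) (b : SpernerInputB d n t)
    {i : Fin (d + 1)} (h : t ≤ (i : ℕ)) : spernerClasses a b i = classesB b i := by
  simp [spernerClasses, classesB, h, not_lt.2 h]

/-- A bound for the number of bits that covers all protocols above. -/
theorem cost_le {d k : ℕ} (hk : 1 ≤ k) :
    k + (k + (k * d * (k + 2) + (k * (d + 1) + 1 + 0) + 1) + 1) + 1 ≤ (4 * d + 7) * k ^ 2 := by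
  nlinarith [Nat.mul_le_mul hk hk, Nat.mul_le_mul_left d (Nat.mul_le_mul_left k hk),
    Nat.mul_le_mul_left k hk]

theorem one_le_clog (T : SimplexTriangulation d n) (hd : 1 ≤ d) : 1 ≤ Nat.clog 2 n :=
  Nat.clog_pos one_lt_two (by have := T.succ_le_card_vertices; omega)

theorem exists_protocol_pred (T : SimplexTriangulation d n) (hd : 1 ≤ d) :
    ∃ P : CommProtocol (SpernerInputA d n (d - 1)) (SpernerInputB d n (d - 1)) (SpernerOutput d n),
      P.Solves (T.concatSperner (d - 1)) ∧
        (P.cost : ℝ) ≤ (4 * (4 * d + 7) : ℝ) * Real.logb 2 (n : ℝ) ^ 2 := by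
  refine exists_protocol hd (cost_le (T.one_le_clog hd)) (solvable_of_all_but_two
    (by have := T.succ_le_card_vertices; omega) (Nat.le_pow_clog one_lt_two n)
    (i := ⟨d - 1, by omega⟩) (j := ⟨d, by omega⟩) (by simp [Fin.ext_iff]; omega)
    classesA (fun b => classesB b _) (fun b => classesB b _) (fun a b l h1 h2 => ?_)
    (fun a b => spernerClasses_of_le a b le_rfl)
    (fun a b => spernerClasses_of_le a b (Nat.sub_le d 1)))
  simp only [ne_eq, Fin.ext_iff] at h1 h2
  exact spernerClasses_of_lt a b (by omega)

theorem exists_protocol_two (T : SimplexTriangulation d n) (hd : 1 ≤ d) :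
    ∃ P : CommProtocol (SpernerInputA d n 2) (SpernerInputB d n 2) (SpernerOutput d n),
      P.Solves (T.concatSperner 2) ∧
        (P.cost : ℝ) ≤ (4 * (4 * d + 7) : ℝ) * Real.logb 2 (n : ℝ) ^ 2 := by
  refine exists_protocol hd (cost_le (T.one_le_clog hd)) (Solvable.swap
    (D := fun _ _ => True) (R := fun b a => T.IsValid (spernerClasses a b))
    (solvable_of_all_but_two
    (by have := T.succ_le_card_vertices; omega) (Nat.le_pow_clog one_lt_two n)
    (i := ⟨0, by omega⟩) (j := ⟨1, by omega⟩) (by simp [Fin.ext_iff])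
    classesB (fun a => classesA a _) (fun a => classesA a _) (fun b a l h1 h2 => ?_)
    (fun b a => spernerClasses_of_lt a b two_pos)
    (fun b a => spernerClasses_of_lt a b one_lt_two)))
  simp only [ne_eq, Fin.ext_iff] at h1 h2
  exact spernerClasses_of_le a b (by omega)

theorem exists_protocol_zero (T : SimplexTriangulation d n) (hd : 1 ≤ d) :
    ∃ P : CommProtocol (SpernerInputA d n 0) (SpernerInputB d n 0) (SpernerOutput d n),
      P.Solves (T.concatSperner 0) ∧
        (P.cost : ℝ) ≤ (4 * (4 * d + 7) : ℝ) * Real.logb 2 (n : ℝ) ^ 2 :=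
  exists_protocol hd (le_trans (by omega) (cost_le (T.one_le_clog hd))) (Solvable.swap
    (D := fun _ _ => True) (R := fun b a => T.IsValid (spernerClasses a b))
    (solvable_of_all (by have := T.succ_le_card_vertices; omega) (Nat.le_pow_clog one_lt_two n)
      classesB fun _ _ => funext fun _ => spernerClasses_of_le _ _ (Nat.zero_le _)))

theorem exists_protocol_one (T : SimplexTriangulation d n) (hd : 1 ≤ d) :
    ∃ P : CommProtocol (SpernerInputA d n 1) (SpernerInputB d n 1) (SpernerOutput d n),
      P.Solves (T.concatSperner 1) ∧
        (P.cost : ℝ) ≤ (4 * (4 * d + 7) : ℝ) * Real.logb 2 (n : ℝ) ^ 2 := by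
  refine exists_protocol hd (le_trans (by omega) (cost_le (T.one_le_clog hd))) (Solvable.swap
    (D := fun _ _ => True) (R := fun b a => T.IsValid (spernerClasses a b))
    (solvable_of_all_but_one
    (by have := T.succ_le_card_vertices; omega) (Nat.le_pow_clog one_lt_two n) ⟨0, by omega⟩
    classesB (fun a => classesA a _) (fun b a l h1 => ?_)
    (fun b a => spernerClasses_of_lt a b one_pos)))
  simp only [ne_eq, Fin.ext_iff] at h1
  exact spernerClasses_of_le a b (by omega)

theorem exists_protocol_self (T : SimplexTriangulation d n) (hd : 1 ≤ d) :
    ∃ P : CommProtocol (SpernerInputA d n d) (SpernerInputB d n d) (SpernerOutput d n),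
      P.Solves (T.concatSperner d) ∧
        (P.cost : ℝ) ≤ (4 * (4 * d + 7) : ℝ) * Real.logb 2 (n : ℝ) ^ 2 := by
  refine exists_protocol hd (le_trans (by omega) (cost_le (T.one_le_clog hd)))
    (solvable_of_all_but_one
    (by have := T.succ_le_card_vertices; omega) (Nat.le_pow_clog one_lt_two n) ⟨d, by omega⟩
    classesA (fun b => classesB b _) (fun a b l h1 => ?_)
    (fun a b => spernerClasses_of_le a b le_rfl))
  simp only [ne_eq, Fin.ext_iff] at h1
  exact spernerClasses_of_lt a b (by omega)

theorem exists_protocol_succ (T : SimplexTriangulation d n) (hd : 1 ≤ d) :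
    ∃ P : CommProtocol (SpernerInputA d n (d + 1)) (SpernerInputB d n (d + 1)) (SpernerOutput d n),
      P.Solves (T.concatSperner (d + 1)) ∧
        (P.cost : ℝ) ≤ (4 * (4 * d + 7) : ℝ) * Real.logb 2 (n : ℝ) ^ 2 :=
  exists_protocol hd (le_trans (by omega) (cost_le (T.one_le_clog hd)))
    (solvable_of_all (by have := T.succ_le_card_vertices; omega) (Nat.le_pow_clog one_lt_two n)
      classesA fun _ _ => funext fun i => spernerClasses_of_lt _ _ i.2)

end SimplexTriangulation

theorem theorem3 :
    (∀ d : ℕ, 1 ≤ d → ∃ c : ℝ, ∀ (n : ℕ) (T : SimplexTriangulation d n),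
      ∃ P : CommProtocol (SpernerInputA d n (d - 1)) (SpernerInputB d n (d - 1))
          (SpernerOutput d n),
        P.Solves (T.concatSperner (d - 1)) ∧ (P.cost : ℝ) ≤ c * Real.logb 2 (n : ℝ) ^ 2) ∧
    (∀ d : ℕ, 1 ≤ d → d ≤ 4 → ∀ t : ℕ, t ≤ d + 1 →
      ∃ c : ℝ, ∀ (n : ℕ) (T : SimplexTriangulation d n),
        ∃ P : CommProtocol (SpernerInputA d n t) (SpernerInputB d n t) (SpernerOutput d n),
          P.Solves (T.concatSperner t) ∧ (P.cost : ℝ) ≤ c * Real.logb 2 (n : ℝ) ^ 2) := by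
  refine ⟨fun d hd => ⟨_, fun n T => T.exists_protocol_pred hd⟩, fun d hd hd4 t ht => ?_⟩
  refine ⟨4 * (4 * d + 7), fun n T => ?_⟩
  -- The only use of `d ≤ 4`: for `d = 5` and `t = 3` each player would lack three classes.
  have hcases : t = 0 ∨ t = 1 ∨ t = 2 ∨ t = d - 1 ∨ t = d ∨ t = d + 1 := by omega
  rcases hcases with rfl | rfl | rfl | rfl | rfl | rfl
  · exact T.exists_protocol_zero hd
  · exact T.exists_protocol_one hd
  · exact T.exists_protocol_two hd
  · exact T.exists_protocol_pred hd
  · exact T.exists_protocol_self hd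
  · exact T.exists_protocol_succ hd
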